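/- A permutation $\pi$ of length $n$ is a bijection of $\{1,\dots,n\}$, written as the word $\pi(1)\pi(2)\cdots\pi(n)$. An \emph{interval} of $\pi$ is a (possibly empty) set $I$ of contiguous positions such that the set of values $\pi(I)$ is also contiguous; $\pi$ is \emph{simple} if its only intervals are those of lengths $0$, $1$ and $n$ (so the permutations of lengths $0$, $1$ and $2$ are simple). A \emph{one-point deletion} of $\pi$ is the permutation of length $n-1$ that is order isomorphic to the sequence obtained from $\pi(1)\cdots\pi(n)$ by removing one entry. A simple permutation is \emph{exceptional} if none of its one-point deletions is simple. The \emph{symmetries} of $\pi$ are the permutations obtained from $\pi$ by composing any of the operations reversal ($i\mapsto \pi(n+1-i)$), complementation ($i\mapsto n+1-\pi(i)$) and group-theoretic inversion (including $\pi$ itself). Theorem (Albert and Atkinson). Let $n\ge 1$ and let $\pi$ be a permutation of length $n$. Then $\pi$ is exceptional if and only if $n=2m$ for some $m\ge 2$ and $\pi$ is a symmetry of the parallel alternation \[ 2\,4\,6\cdots(2m)\;1\,3\,5\cdots(2m-1). \] -/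

import Mathlib

namespace SimplePerm

/-- A permutation of length `n` is `π : Equiv.Perm (Fin n)`, positions and values being numbered
from `0`. A set `I` of positions is an interval of `π` if `I` is contiguous and the set of values
`π(I)` is contiguous. -/
def IsInterval {n : ℕ} (π : Equiv.Perm (Fin n)) (I : Set (Fin n)) : Prop :=
  I.OrdConnected ∧ (π '' I).OrdConnected

/-- `π` is simple if its only intervals are those with at most one element and the whole of `π`. -/
def IsSimple {n : ℕ} (π : Equiv.Perm (Fin n)) : Prop :=
  ∀ I : Set (Fin n), IsInterval π I → I.Subsingleton ∨ I = Set.univ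

/-- `σ` is a one-point deletion of `π`: for some position `p`, the sequence obtained from `π` by
removing its entry at `p` is order isomorphic to `σ`. Here `f` lists the positions other than `p`
in increasing order. -/
def IsOnePointDeletion {k n : ℕ} (σ : Equiv.Perm (Fin k)) (π : Equiv.Perm (Fin n)) : Prop :=
  ∃ (p : Fin n) (f : Fin k ↪o Fin n), Set.range f = {p}ᶜ ∧
    ∀ i j : Fin k, σ i < σ j ↔ π (f i) < π (f j)

/-- `π` is exceptional if it is simple and none of its one-point deletions is simple. -/
def IsExceptional {n : ℕ} (π : Equiv.Perm (Fin n)) : Prop :=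
  IsSimple π ∧ ∀ (k : ℕ) (σ : Equiv.Perm (Fin k)), IsOnePointDeletion σ π → ¬ IsSimple σ

/-- The permutation `2 4 6 ⋯ (2m) 1 3 5 ⋯ (2m-1)`; numbering positions and values from `0`,
it is `1 3 5 ⋯ (2m-1) 0 2 4 ⋯ (2m-2)`. -/
def parallelAlternation (m : ℕ) : Equiv.Perm (Fin (2 * m)) where
  toFun i := if h : (i : ℕ) < m then ⟨2 * i + 1, by omega⟩ else ⟨2 * (i - m), by omega⟩
  invFun v := if (v : ℕ) % 2 = 1 then ⟨v / 2, by omega⟩ else ⟨m + v / 2, by omega⟩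
  left_inv i := by
    ext
    by_cases h : (i : ℕ) < m
    · have h1 : (2 * (i : ℕ) + 1) % 2 = 1 := by omega
      simp only [h, dite_true, h1, if_true]
      omega
    · have h1 : ¬ (2 * ((i : ℕ) - m)) % 2 = 1 := by omega
      simp only [h, dite_false, h1, if_false]
      omega
  right_inv v := by
    ext
    by_cases h : (v : ℕ) % 2 = 1
    · have h1 : (v : ℕ) / 2 < m := by omega
      simp only [h, if_true, h1, dite_true]
      omega
    · have h1 : ¬ m + (v : ℕ) / 2 < m := by omega
      simp only [h, if_false, h1, dite_false]
      omega

/-- `IsSymmetry π τ`: the permutation `τ` is a symmetry of `π`, that is, the plot of `τ` is the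
image of the plot of `π` under a symmetry of the square. These symmetries are generated by
reversal, complementation and group-theoretic inversion. -/
inductive IsSymmetry {n : ℕ} (π : Equiv.Perm (Fin n)) : Equiv.Perm (Fin n) → Prop
  | refl : IsSymmetry π π
  | reverse {τ : Equiv.Perm (Fin n)} : IsSymmetry π τ → IsSymmetry π (Fin.revPerm.trans τ)
  | complement {τ : Equiv.Perm (Fin n)} : IsSymmetry π τ → IsSymmetry π (τ.trans Fin.revPerm)
  | inverse {τ : Equiv.Perm (Fin n)} : IsSymmetry π τ → IsSymmetry π τ.symm

end SimplePerm

/-!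
A permutation is regarded as a finite set of points with a horizontal coordinate `P` and a vertical
coordinate `Q`, and this as a two-structure: the colour of a pair of points records how it compares
in the two orders. Intervals become modules (`isModule_ordRel_iff`), simple permutations prime
structures, and exceptional permutations critical structures (`IsPlot.isExceptional_iff`).

The theorem of Ehrenfeucht and Rozenberg (`exists_isPrimeOn_insert_insert`) says that prime sets
grow by two elements at a time. Hence in a critical structure every prime set with at least three
elements misses an even number of elements (`IsCritical.even_ncard_compl`). A prime set of at least
three points contains an alternation of length four (`IsPrimeOn.exists_alternation_two`), which is
a prime set, so a critical point set contains none of the six simple patterns of length five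
(`IsCritical.avoidsFive`).

These six patterns leave no freedom. Let an alternation of length `2 * m` be a proper subset of a
critical point set. Two points `x`, `y` extend it to a larger prime set, while by parity neither
does so alone; hence each of them is a twin of a point of the alternation or lies in one of its
corners, and each twin is separated from its partner by the other new point. Every position of `x`
and `y` compatible with this either produces a pattern of length five or turns the alternation into
one of length `2 * (m + 1)` (`IsCritical.exists_enlarge`). For `m = 2` this may require a quarter
turn, under which the alternation of length four is invariant. So a critical point set is an
alternation up to a symmetry of the square (`IsCritical.exists_alternation`), and a permutation is
determined by the fact that its plot is an alternation (`IsPlot.eq_of_isAlternation`). Conversely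
alternations are critical (`IsAlternation.isCritical`).
-/

namespace SimplePerm

/-! ### Modules and prime sets of a two-structure -/

section TwoStructure

variable {V C : Type*} {r : V → V → C} {X M S T : Set V} {u v x y z : V}

/-- `M` is a module of the substructure of `r` on `S`: no element of `S` outside `M` tells two
elements of `M` apart. -/
def IsModule (r : V → V → C) (S M : Set V) : Prop :=
  M ⊆ S ∧ ∀ z ∈ S, z ∉ M → ∀ a ∈ M, ∀ b ∈ M, r z a = r z b

/-- The substructure of `r` on `S` is prime: its only modules are the sets with at most one element
and `S` itself. -/
def IsPrimeOn (r : V → V → C) (S : Set V) : Prop :=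
  ∀ M, IsModule r S M → M.Subsingleton ∨ M = S

/-- If two pairs with the same first vertex have the same colour, then so do the reversed pairs. -/
def IsReversible (r : V → V → C) : Prop :=
  ∀ a b c, a ≠ b → a ≠ c → r a b = r a c → r b a = r c a

/-- No element of `X` other than `u` tells `x` from `u`. For `x ∉ X` this says that `{u, x}` is a
module on `X ∪ {x}`. -/
def IsTwin (r : V → V → C) (X : Set V) (u x : V) : Prop :=
  u ∈ X ∧ ∀ w ∈ X, w ≠ u → r w x = r w u

/-- `x` does not tell the elements of `X` apart. For `x ∉ X` this says that `X` is a module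
on `X ∪ {x}`. -/
def IsUniform (r : V → V → C) (X : Set V) (x : V) : Prop :=
  ∀ a ∈ X, ∀ b ∈ X, r x a = r x b

theorem IsModule.inter (hM : IsModule r S M) (hT : T ⊆ S) : IsModule r T (M ∩ T) :=
  ⟨Set.inter_subset_right, fun z hz hzM a ha b hb =>
    hM.2 z (hT hz) (fun h => hzM ⟨h, hz⟩) a ha.1 b hb.1⟩

/-- A module of a larger set meets a prime set in at most one element or contains it. -/
theorem IsPrimeOn.subsingleton_or_subset (hX : IsPrimeOn r X) (hXS : X ⊆ S)
    (hM : IsModule r S M) : (∀ a ∈ M, ∀ b ∈ M, a ∈ X → b ∈ X → a = b) ∨ X ⊆ M := by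
  rcases hX _ (hM.inter hXS) with h | h
  · exact Or.inl fun a ha b hb haX hbX => h ⟨ha, haX⟩ ⟨hb, hbX⟩
  · exact Or.inr (Set.inter_eq_right.mp h)

theorem exists_module_of_not_isPrimeOn (h : ¬ IsPrimeOn r S) :
    ∃ M, IsModule r S M ∧ (∃ a ∈ M, ∃ b ∈ M, a ≠ b) ∧ ∃ s ∈ S, s ∉ M := by
  simp only [IsPrimeOn, not_forall, not_or] at h
  obtain ⟨M, hM, h1, h2⟩ := h
  refine ⟨M, hM, ?_, ?_⟩
  · rw [Set.not_subsingleton_iff] at h1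
    exact h1
  · by_contra! h3
    exact h2 (hM.1.antisymm h3)

theorem twin_or_uniform_of_not_isPrimeOn_insert (hX : IsPrimeOn r X)
    (h : ¬ IsPrimeOn r (insert x X)) : (∃ u, IsTwin r X u x) ∨ IsUniform r X x := by
  obtain ⟨M, hM, ⟨a, ha, b, hb, hab⟩, s, hs, hsM⟩ := exists_module_of_not_isPrimeOn h
  have hsub := hM.1
  rcases hX.subsingleton_or_subset (Set.subset_insert x X) hM with h1 | h1
  · left
    have key : ∃ u ∈ M, u ∈ X ∧ x ∈ M := by
      rcases hsub ha with rfl | haX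
      · rcases hsub hb with rfl | hbX
        · exact absurd rfl hab
        · exact ⟨b, hb, hbX, ha⟩
      · rcases hsub hb with rfl | hbX
        · exact ⟨a, ha, haX, hb⟩
        · exact absurd (h1 a ha b hb haX hbX) hab
    obtain ⟨u, hu, huX, hxM⟩ := key
    exact ⟨u, huX, fun w hw hwu =>
      hM.2 w (Or.inr hw) (fun hwM => hwu (h1 w hwM u hu hw huX)) x hxM u hu⟩
  · right
    rcases hs with rfl | hs
    · exact fun a ha b hb => hM.2 s (Or.inl rfl) hsM a (h1 ha) b (h1 hb)
    · exact absurd (h1 hs) hsM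

/-- An element of a prime set with at least three elements tells two of the others apart. -/
theorem IsPrimeOn.not_uniform_diff (hX : IsPrimeOn r X) (h3 : ∀ u v, ∃ w ∈ X, w ≠ u ∧ w ≠ v)
    (hu : u ∈ X) : ¬ ∀ a ∈ X, ∀ b ∈ X, a ≠ u → b ≠ u → r u a = r u b := by
  intro h
  have hmod : IsModule r X (X \ {u}) := by
    refine ⟨Set.sdiff_subset, fun z hz hzM a ha b hb => ?_⟩
    have : z = u := by
      by_contra hne
      exact hzM ⟨hz, hne⟩
    subst this
    exact h a ha.1 b hb.1 ha.2 hb.2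
  obtain ⟨a, haX, hau, -⟩ := h3 u u
  obtain ⟨b, hbX, hbu, hba⟩ := h3 u a
  rcases hX _ hmod with h1 | h1
  · exact hba (h1 ⟨hbX, hbu⟩ ⟨haX, hau⟩)
  · have : u ∈ X \ {u} := by rw [h1]; exact hu
    exact this.2 rfl

/-- Two elements of a prime set with at least three elements are told apart by a third one. -/
theorem IsPrimeOn.not_twin_pair (hX : IsPrimeOn r X) (h3 : ∀ u v, ∃ w ∈ X, w ≠ u ∧ w ≠ v)
    (hu : u ∈ X) (hv : v ∈ X) (huv : u ≠ v) :
    ¬ ∀ w ∈ X, w ≠ u → w ≠ v → r w u = r w v := by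
  intro h
  have hmod : IsModule r X {u, v} := by
    refine ⟨?_, fun z hz hzM a ha b hb => ?_⟩
    · rintro a (rfl | rfl) <;> assumption
    · have hzu : z ≠ u := fun e => hzM (Or.inl e)
      have hzv : z ≠ v := fun e => hzM (Or.inr e)
      have := h z hz hzu hzv
      rcases ha with rfl | rfl <;> rcases hb with rfl | rfl <;> simp [this]
  obtain ⟨w, hwX, hwu, hwv⟩ := h3 u v
  rcases hX _ hmod with h1 | h1
  · exact huv (h1 (Or.inl rfl) (Or.inr rfl))
  · have : w ∈ ({u, v} : Set V) := by rw [h1]; exact hwX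
    rcases this with rfl | rfl
    · exact hwu rfl
    · exact hwv rfl

theorem IsPrimeOn.not_twin_and_uniform (hr : IsReversible r) (hX : IsPrimeOn r X)
    (h3 : ∀ u v, ∃ w ∈ X, w ≠ u ∧ w ≠ v) (hx : x ∉ X) (h1 : IsTwin r X u x)
    (h2 : IsUniform r X x) : False := by
  refine hX.not_uniform_diff h3 h1.1 fun a ha b hb hau hbu => ?_
  have e1 := hr a x u (fun e => hx (e ▸ ha)) hau (h1.2 a ha hau)
  have e2 := hr b x u (fun e => hx (e ▸ hb)) hbu (h1.2 b hb hbu)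
  rw [← e1, ← e2]
  exact h2 a ha b hb

/-- If adding `x` and `y` to a prime set does not give a prime set, and `x` is a twin of `u` while
`y` is not, then `y` does not tell `u` from `x` either. -/
theorem IsTwin.eq_of_not_isPrimeOn (hr : IsReversible r) (hX : IsPrimeOn r X)
    (h3 : ∀ u v, ∃ w ∈ X, w ≠ u ∧ w ≠ v) (hx : x ∉ X) (hy : y ∉ X) (hxy : x ≠ y)
    (h1 : IsTwin r X u x) (h2 : ¬ IsTwin r X u y)
    (h : ¬ IsPrimeOn r (insert x (insert y X))) : r y u = r y x := by
  obtain ⟨M, hM, ⟨a, ha, b, hb, hab⟩, s, hs, hsM⟩ := exists_module_of_not_isPrimeOn h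
  have hsub := hM.1
  have hXS : X ⊆ insert x (insert y X) := fun z hz => Or.inr (Or.inr hz)
  have hxS : x ∈ insert x (insert y X) := Or.inl rfl
  have hyS : y ∈ insert x (insert y X) := Or.inr (Or.inl rfl)
  have hneX : ∀ w ∈ X, w ≠ x ∧ w ≠ y := fun w hw =>
    ⟨fun e => hx (e ▸ hw), fun e => hy (e ▸ hw)⟩
  by_contra hcon
  rcases hX.subsingleton_or_subset hXS hM with h4 | h4
  · by_cases hv : ∃ v ∈ M, v ∈ X
    · obtain ⟨v, hvM, hvX⟩ := hv
      have hout : ∀ w ∈ X, w ≠ v → w ∉ M := fun w hw hwv hwM => hwv (h4 w hwM v hvM hw hvX)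
      by_cases hxM : x ∈ M
      · by_cases huv : v = u
        · subst huv
          by_cases hyM : y ∈ M
          · exact h2 ⟨hvX, fun w hw hwv => hM.2 w (hXS hw) (hout w hw hwv) y hyM v hvM⟩
          · exact hcon (hM.2 y hyS hyM v hvM x hxM)
        · refine hX.not_twin_pair h3 h1.1 hvX (Ne.symm huv) fun w hw hwu hwv => ?_
          rw [← h1.2 w hw hwu]
          exact hM.2 w (hXS hw) (hout w hw hwv) x hxM v hvM
      · have hyM : y ∈ M := by
          by_contra hyM
          have : ∀ c ∈ M, c = v := by
            intro c hc
            rcases hsub hc with rfl | rfl | hcX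
            · exact absurd hc hxM
            · exact absurd hc hyM
            · exact h4 c hc v hvM hcX hvX
          exact hab ((this a ha).trans (this b hb).symm)
        have huv : v ≠ u := by
          rintro rfl
          exact h2 ⟨hvX, fun w hw hwv => hM.2 w (hXS hw) (hout w hw hwv) y hyM v hvM⟩
        have e1 := hr u y v (hneX u h1.1).2 huv.symm
          (hM.2 u (hXS h1.1) (hout u h1.1 huv.symm) y hyM v hvM)
        have e2 := hr x y v hxy (hneX v hvX).1.symm (hM.2 x hxS hxM y hyM v hvM)
        exact hcon (by rw [e1, e2, h1.2 v hvX huv])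
    · push Not at hv
      have hxyM : x ∈ M ∧ y ∈ M := by
        rcases hsub ha with rfl | rfl | haX
        · rcases hsub hb with rfl | rfl | hbX
          · exact absurd rfl hab
          · exact ⟨ha, hb⟩
          · exact absurd hbX (hv b hb)
        · rcases hsub hb with rfl | rfl | hbX
          · exact ⟨hb, ha⟩
          · exact absurd rfl hab
          · exact absurd hbX (hv b hb)
        · exact absurd haX (hv a ha)
      refine h2 ⟨h1.1, fun w hw hwu => ?_⟩
      rw [← h1.2 w hw hwu]
      exact hM.2 w (hXS hw) (fun hwM => hv w hwM hw) y hxyM.2 x hxyM.1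
  · by_cases hxM : x ∈ M
    · have hyM : y ∉ M := by
        intro hyM
        rcases hs with rfl | rfl | hs
        · exact hsM hxM
        · exact hsM hyM
        · exact hsM (h4 hs)
      exact hcon (hM.2 y hyS hyM u (h4 h1.1) x hxM)
    · exact hX.not_twin_and_uniform hr h3 hx h1
        fun a ha b hb => hM.2 x hxS hxM a (h4 ha) b (h4 hb)

/-- If adding `x` and `y` to a prime set does not give a prime set, and `x` is uniform on it while
`y` is not, then `x` does not tell `y` from the prime set. -/
theorem IsUniform.eq_of_not_isPrimeOn (hr : IsReversible r) (hX : IsPrimeOn r X)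
    (h3 : ∀ u v, ∃ w ∈ X, w ≠ u ∧ w ≠ v) (hx : x ∉ X) (hy : y ∉ X)
    (h1 : IsUniform r X x) (h2 : ¬ IsUniform r X y)
    (h : ¬ IsPrimeOn r (insert x (insert y X))) (hv : v ∈ X) : r x y = r x v := by
  obtain ⟨M, hM, ⟨a, ha, b, hb, hab⟩, s, hs, hsM⟩ := exists_module_of_not_isPrimeOn h
  have hsub := hM.1
  have hXS : X ⊆ insert x (insert y X) := fun z hz => Or.inr (Or.inr hz)
  have hxS : x ∈ insert x (insert y X) := Or.inl rfl
  have hyS : y ∈ insert x (insert y X) := Or.inr (Or.inl rfl)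
  have hneX : ∀ w ∈ X, w ≠ x ∧ w ≠ y := fun w hw =>
    ⟨fun e => hx (e ▸ hw), fun e => hy (e ▸ hw)⟩
  rcases hX.subsingleton_or_subset hXS hM with h4 | h4
  · by_cases hv : ∃ v ∈ M, v ∈ X
    · obtain ⟨w, hwM, hwX⟩ := hv
      have hout : ∀ z ∈ X, z ≠ w → z ∉ M := fun z hz hzw hzM => hzw (h4 z hzM w hwM hz hwX)
      by_cases hxM : x ∈ M
      · exfalso
        refine hX.not_uniform_diff h3 hwX fun c hc d hd hcw hdw => ?_
        have e1 := hr c x w (hneX c hc).1 hcw (hM.2 c (hXS hc) (hout c hc hcw) x hxM w hwM)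
        have e2 := hr d x w (hneX d hd).1 hdw (hM.2 d (hXS hd) (hout d hd hdw) x hxM w hwM)
        rw [← e1, ← e2]
        exact h1 c hc d hd
      · have hyM : y ∈ M := by
          by_contra hyM
          have : ∀ c ∈ M, c = w := by
            intro c hc
            rcases hsub hc with rfl | rfl | hcX
            · exact absurd hc hxM
            · exact absurd hc hyM
            · exact h4 c hc w hwM hcX hwX
          exact hab ((this a ha).trans (this b hb).symm)
        rw [hM.2 x hxS hxM y hyM w hwM]
        exact h1 w hwX _ ‹_›
    · exfalso
      push Not at hv
      have hxyM : x ∈ M ∧ y ∈ M := by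
        rcases hsub ha with rfl | rfl | haX
        · rcases hsub hb with rfl | rfl | hbX
          · exact absurd rfl hab
          · exact ⟨ha, hb⟩
          · exact absurd hbX (hv b hb)
        · rcases hsub hb with rfl | rfl | hbX
          · exact ⟨hb, ha⟩
          · exact absurd rfl hab
          · exact absurd hbX (hv b hb)
        · exact absurd haX (hv a ha)
      have key : ∀ c ∈ X, r x c = r y c := fun c hc =>
        hr c x y (hneX c hc).1 (hneX c hc).2
          (hM.2 c (hXS hc) (fun hcM => hv c hcM hc) x hxyM.1 y hxyM.2)
      refine h2 fun c hc d hd => ?_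
      rw [← key c hc, ← key d hd]
      exact h1 c hc d hd
  · have hyM : y ∈ M := by
      by_contra hyM
      exact h2 fun c hc d hd => hM.2 y hyS hyM c (h4 hc) d (h4 hd)
    have hxM : x ∉ M := by
      intro hxM
      rcases hs with rfl | rfl | hs
      · exact hsM hxM
      · exact hsM hyM
      · exact hsM (h4 hs)
    exact hM.2 x hxS hxM y hyM v (h4 hv)

/-- If `x` and `y` each extend `X` to a prime set but not both together, then no element of `X`
tells `x` from `y`. -/
theorem eq_of_isPrimeOn_insert_of_not_isPrimeOn (h3 : ∀ u v, ∃ w ∈ X, w ≠ u ∧ w ≠ v)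
    (hx : x ∉ X) (hy : y ∉ X) (hPx : IsPrimeOn r (insert x X)) (hPy : IsPrimeOn r (insert y X))
    (h : ¬ IsPrimeOn r (insert x (insert y X))) (hv : v ∈ X) : r v x = r v y := by
  obtain ⟨M, hM, ⟨a, ha, b, hb, hab⟩, s, hs, hsM⟩ := exists_module_of_not_isPrimeOn h
  have hsub := hM.1
  have hXS : X ⊆ insert x (insert y X) := fun z hz => Or.inr (Or.inr hz)
  have hSx : insert x X ⊆ insert x (insert y X) := Set.insert_subset_insert (Set.subset_insert y X)
  have hSy : insert y X ⊆ insert x (insert y X) := Set.subset_insert x _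
  obtain ⟨c, hcX, -, -⟩ := h3 v v
  obtain ⟨d, hdX, hdc, -⟩ := h3 c c
  have nsub : ¬ X ⊆ M := by
    intro hXM
    rcases hPx.subsingleton_or_subset hSx hM with h1 | h1
    · exact hdc (h1 d (hXM hdX) c (hXM hcX) (Or.inr hdX) (Or.inr hcX))
    rcases hPy.subsingleton_or_subset hSy hM with h2 | h2
    · exact hdc (h2 d (hXM hdX) c (hXM hcX) (Or.inr hdX) (Or.inr hcX))
    rcases hs with rfl | rfl | hs
    · exact hsM (h1 (Or.inl rfl))
    · exact hsM (h2 (Or.inl rfl))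
    · exact hsM (hXM hs)
  have h1 := (hPx.subsingleton_or_subset hSx hM).resolve_right
    fun hh => nsub ((Set.subset_insert x X).trans hh)
  have h2 := (hPy.subsingleton_or_subset hSy hM).resolve_right
    fun hh => nsub ((Set.subset_insert y X).trans hh)
  have hnone : ∀ w ∈ M, w ∉ X := by
    intro w hwM hwX
    have : ∀ e ∈ M, e = w := by
      intro e he
      rcases hsub he with rfl | rfl | heX
      · exact h1 e he w hwM (Or.inl rfl) (Or.inr hwX)
      · exact h2 e he w hwM (Or.inl rfl) (Or.inr hwX)
      · exact h1 e he w hwM (Or.inr heX) (Or.inr hwX)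
    exact hab ((this a ha).trans (this b hb).symm)
  have hxyM : x ∈ M ∧ y ∈ M := by
    rcases hsub ha with rfl | rfl | haX
    · rcases hsub hb with rfl | rfl | hbX
      · exact absurd rfl hab
      · exact ⟨ha, hb⟩
      · exact absurd hbX (hnone b hb)
    · rcases hsub hb with rfl | rfl | hbX
      · exact ⟨hb, ha⟩
      · exact absurd rfl hab
      · exact absurd hbX (hnone b hb)
    · exact absurd haX (hnone a ha)
  exact hM.2 v (hXS hv) (fun h => hnone v h hv) x hxyM.1 y hxyM.2

/-- The theorem of Ehrenfeucht and Rozenberg: in a prime structure, a prime set with at least three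
elements that misses at least two elements can be enlarged to a prime set by two elements. -/
theorem exists_isPrimeOn_insert_insert (hr : IsReversible r) (hV : IsPrimeOn r Set.univ)
    (hX : IsPrimeOn r X) (h3 : ∀ u v, ∃ w ∈ X, w ≠ u ∧ w ≠ v)
    (h2 : ∃ x y, x ∉ X ∧ y ∉ X ∧ x ≠ y) :
    ∃ x y, x ∉ X ∧ y ∉ X ∧ x ≠ y ∧ IsPrimeOn r (insert x (insert y X)) := by
  by_contra! hno
  have htwin : ∀ u x, x ∉ X → ¬ IsTwin r X u x := by
    intro u x hx hux
    -- the class of all twins of `u` would be a module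
    have hmod : IsModule r Set.univ {z | z = u ∨ (z ∉ X ∧ IsTwin r X u z)} := by
      refine ⟨Set.subset_univ _, fun z _ hzM => ?_⟩
      have hzu : z ≠ u := fun e => hzM (Or.inl e)
      have key : ∀ a, (a = u ∨ (a ∉ X ∧ IsTwin r X u a)) → r z a = r z u := by
        rintro a (rfl | ⟨haX, hat⟩)
        · rfl
        · by_cases hzX : z ∈ X
          · exact hat.2 z hzX hzu
          · have hza : a ≠ z := fun e => hzM (Or.inr ⟨hzX, e ▸ hat⟩)
            exact (hat.eq_of_not_isPrimeOn hr hX h3 haX hzX hza (fun h => hzM (Or.inr ⟨hzX, h⟩))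
              (hno a z haX hzX hza)).symm
      exact fun a ha b hb => (key a ha).trans (key b hb).symm
    rcases hV _ hmod with h | h
    · exact hx (h (Or.inr ⟨hx, hux⟩ : x ∈ {z | z = u ∨ (z ∉ X ∧ IsTwin r X u z)})
        (Or.inl rfl) ▸ hux.1)
    · obtain ⟨w, hw, hwu, -⟩ := h3 u u
      have : w ∈ {z | z = u ∨ (z ∉ X ∧ IsTwin r X u z)} := by rw [h]; trivial
      rcases this with e | e
      · exact hwu e
      · exact e.1 hw
  obtain ⟨c, hcX, -, -⟩ := h3 h2.choose h2.choose
  obtain ⟨d, hdX, hdc, -⟩ := h3 c c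
  have hunif : ∀ x, x ∉ X → ¬ IsUniform r X x := by
    intro x hx hux
    have hmod : IsModule r Set.univ {z | z ∈ X ∨ ¬ IsUniform r X z} := by
      refine ⟨Set.subset_univ _, fun z _ hzM => ?_⟩
      have hzX : z ∉ X := fun h => hzM (Or.inl h)
      have hzu : IsUniform r X z := by
        by_contra h
        exact hzM (Or.inr h)
      have key : ∀ a, (a ∈ X ∨ ¬ IsUniform r X a) → r z a = r z c := by
        intro a ha
        by_cases haX : a ∈ X
        · exact hzu a haX c hcX
        · have ha' := ha.resolve_left haX
          have hza : z ≠ a := fun e => ha' (e ▸ hzu)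
          exact hzu.eq_of_not_isPrimeOn hr hX h3 hzX haX ha' (hno z a hzX haX hza) hcX
      exact fun a ha b hb => (key a ha).trans (key b hb).symm
    rcases hV _ hmod with h | h
    · exact hdc (h (Or.inl hdX) (Or.inl hcX))
    · have : x ∈ {z | z ∈ X ∨ ¬ IsUniform r X z} := by rw [h]; trivial
      exact this.elim hx fun h => h hux
  have hprime : ∀ x, x ∉ X → IsPrimeOn r (insert x X) := by
    intro x hx
    by_contra h
    rcases twin_or_uniform_of_not_isPrimeOn_insert hX h with ⟨u, hu⟩ | hu
    · exact htwin u x hx hu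
    · exact hunif x hx hu
  have hmod : IsModule r Set.univ Xᶜ := by
    refine ⟨Set.subset_univ _, fun z _ hz a ha b hb => ?_⟩
    by_cases hab : a = b
    · rw [hab]
    · exact eq_of_isPrimeOn_insert_of_not_isPrimeOn h3 ha hb (hprime a ha) (hprime b hb)
        (hno a b ha hb hab) (not_not.mp hz)
  obtain ⟨x, y, hx, hy, hxy⟩ := h2
  rcases hV _ hmod with h | h
  · exact hxy (h hx hy)
  · have : c ∈ Xᶜ := by rw [h]; trivial
    exact this hcX

/-- A structure is critical if it is prime and removing any one element leaves a structure that is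
not prime. -/
def IsCritical (r : V → V → C) : Prop :=
  IsPrimeOn r Set.univ ∧ ∀ p, ¬ IsPrimeOn r {p}ᶜ

/-- Prime sets grow two elements at a time, so in a critical structure each of them (apart from the
very small ones) misses an even number of elements. -/
theorem IsCritical.even_ncard_compl [Finite V] (hr : IsReversible r) (hV : IsCritical r)
    (hX : IsPrimeOn r X) (h3 : ∀ u v, ∃ w ∈ X, w ≠ u ∧ w ≠ v) : Even (Xᶜ).ncard := by
  induction hk : (Xᶜ).ncard using Nat.strong_induction_on generalizing X with
  | _ k ih =>
    rcases Nat.lt_or_ge k 2 with hk2 | hk2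
    · interval_cases k
      · exact Even.zero
      · exfalso
        obtain ⟨p, hp⟩ := Set.ncard_eq_one.mp hk
        exact hV.2 p (by rw [← hp, compl_compl]; exact hX)
    · obtain ⟨x, hx, y, hy, hxy⟩ := (Set.one_lt_ncard).mp (show 1 < (Xᶜ).ncard by omega)
      obtain ⟨x, y, hx, hy, hxy, hp⟩ :=
        exists_isPrimeOn_insert_insert hr hV.1 hX h3 ⟨x, y, hx, hy, hxy⟩
      have hcard : ((insert x (insert y X))ᶜ).ncard + 2 = (Xᶜ).ncard := by
        have hxm : x ∈ Xᶜ \ {y} := ⟨hx, hxy⟩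
        have e : (insert x (insert y X))ᶜ = (Xᶜ \ {y}) \ {x} := by
          ext z
          simp only [Set.mem_compl_iff, Set.mem_insert_iff, Set.mem_sdiff, Set.mem_singleton_iff]
          tauto
        have e1 := Set.ncard_sdiff_singleton_add_one hxm
        have e2 := Set.ncard_sdiff_singleton_add_one (show y ∈ Xᶜ from hy)
        rw [e]
        omega
      have := ih _ (by omega) hp (fun u v => by
        obtain ⟨w, hw, h⟩ := h3 u v
        exact ⟨w, Or.inr (Or.inr hw), h⟩) rfl
      rw [← hk, ← hcard]
      exact this.add even_two

end TwoStructure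

/-! ### Point sets in the plane -/

section PointSet

variable {V : Type*} {P Q P' Q' P'' Q'' : V → ℤ} {X M S : Set V} {a b u x z : V}

/-- The two-structure of a set of points with horizontal coordinates `P` and vertical
coordinates `Q`: the colour of a pair records the comparison in each of the two orders. -/
def ordRel (P Q : V → ℤ) (a b : V) : Prop × Prop := (P a < P b, Q a < Q b)

theorem ordRel_eq_iff :
    ordRel P Q z a = ordRel P Q z b ↔ (P z < P a ↔ P z < P b) ∧ (Q z < Q a ↔ Q z < Q b) := by
  simp [ordRel]

theorem isReversible_ordRel (hP : P.Injective) (hQ : Q.Injective) :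
    IsReversible (ordRel P Q) := by
  intro a b c hab hac h
  rw [ordRel] at h
  have h1 := hP.ne hab
  have h2 := hP.ne hac
  have h3 := hQ.ne hab
  have h4 := hQ.ne hac
  simp only [ordRel, Prod.mk.injEq, eq_iff_iff] at h ⊢
  omega

/-- Modules are the sets that are convex in both orders. -/
theorem isModule_ordRel_iff (hP : P.Injective) (hQ : Q.Injective) :
    IsModule (ordRel P Q) S M ↔ M ⊆ S ∧ ∀ z ∈ S, ∀ a ∈ M, ∀ b ∈ M,
      (P a < P z → P z < P b → z ∈ M) ∧ (Q a < Q z → Q z < Q b → z ∈ M) := by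
  refine and_congr_right fun _ => ⟨fun h z hz a ha b hb => ?_, fun h z hz hzM a ha b hb => ?_⟩
  · by_cases hzM : z ∈ M
    · exact ⟨fun _ _ => hzM, fun _ _ => hzM⟩
    · have := ordRel_eq_iff.mp (h z hz hzM a ha b hb)
      constructor <;> intros <;> omega
  · have h1 := hP.ne (show z ≠ a from fun e => hzM (e ▸ ha))
    have h2 := hP.ne (show z ≠ b from fun e => hzM (e ▸ hb))
    have h3 := hQ.ne (show z ≠ a from fun e => hzM (e ▸ ha))
    have h4 := hQ.ne (show z ≠ b from fun e => hzM (e ▸ hb))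
    have h5 := h z hz a ha b hb
    have h6 := h z hz b hb a ha
    simp only [hzM, imp_false, not_lt] at h5 h6
    rw [ordRel_eq_iff]
    omega

/-- `SymmForm P Q P' Q'`: the point set with coordinates `P'`, `Q'` is the image of the one with
coordinates `P`, `Q` under a symmetry of the square. -/
inductive SymmForm (P Q : V → ℤ) : (V → ℤ) → (V → ℤ) → Prop
  | refl : SymmForm P Q P Q
  | negPos {P' Q' : V → ℤ} : SymmForm P Q P' Q' → SymmForm P Q (-P') Q'
  | negVal {P' Q' : V → ℤ} : SymmForm P Q P' Q' → SymmForm P Q P' (-Q')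
  | swap {P' Q' : V → ℤ} : SymmForm P Q P' Q' → SymmForm P Q Q' P'

theorem SymmForm.trans (h : SymmForm P Q P' Q') (h' : SymmForm P' Q' P'' Q'') :
    SymmForm P Q P'' Q'' := by
  induction h' with
  | refl => exact h
  | negPos _ ih => exact ih.negPos
  | negVal _ ih => exact ih.negVal
  | swap _ ih => exact ih.swap

theorem SymmForm.injective (h : SymmForm P Q P' Q') (hP : P.Injective) (hQ : Q.Injective) :
    P'.Injective ∧ Q'.Injective := by
  induction h with
  | refl => exact ⟨hP, hQ⟩
  | negPos _ ih => exact ⟨fun a b h => ih.1 (neg_injective h), ih.2⟩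
  | negVal _ ih => exact ⟨ih.1, fun a b h => ih.2 (neg_injective h)⟩
  | swap _ ih => exact ih.symm

theorem SymmForm.ordRel_eq_iff (h : SymmForm P Q P' Q') (hP : P.Injective) (hQ : Q.Injective)
    (hza : z ≠ a) (hzb : z ≠ b) :
    ordRel P' Q' z a = ordRel P' Q' z b ↔ ordRel P Q z a = ordRel P Q z b := by
  induction h with
  | refl => rfl
  | negPos h ih =>
    have h1 := (h.injective hP hQ).1.ne hza
    have h2 := (h.injective hP hQ).1.ne hzb
    rw [← ih, SimplePerm.ordRel_eq_iff, SimplePerm.ordRel_eq_iff]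
    simp only [Pi.neg_apply]
    omega
  | negVal h ih =>
    have h1 := (h.injective hP hQ).2.ne hza
    have h2 := (h.injective hP hQ).2.ne hzb
    rw [← ih, SimplePerm.ordRel_eq_iff, SimplePerm.ordRel_eq_iff]
    simp only [Pi.neg_apply]
    omega
  | swap h ih =>
    rw [← ih, SimplePerm.ordRel_eq_iff, SimplePerm.ordRel_eq_iff]
    exact and_comm

theorem SymmForm.isModule_iff (h : SymmForm P Q P' Q') (hP : P.Injective) (hQ : Q.Injective) :
    IsModule (ordRel P' Q') S M ↔ IsModule (ordRel P Q) S M := by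
  refine and_congr_right fun _ => forall₃_congr fun z _ hzM => forall₄_congr fun a ha b hb => ?_
  exact h.ordRel_eq_iff hP hQ (fun e => hzM (e ▸ ha)) (fun e => hzM (e ▸ hb))

theorem SymmForm.isPrimeOn_iff (h : SymmForm P Q P' Q') (hP : P.Injective) (hQ : Q.Injective) :
    IsPrimeOn (ordRel P' Q') S ↔ IsPrimeOn (ordRel P Q) S := by
  simp only [IsPrimeOn, h.isModule_iff hP hQ]

theorem SymmForm.isCritical_iff (h : SymmForm P Q P' Q') (hP : P.Injective) (hQ : Q.Injective) :
    IsCritical (ordRel P' Q') ↔ IsCritical (ordRel P Q) := by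
  simp only [IsCritical, h.isPrimeOn_iff hP hQ]

theorem SymmForm.isTwin_iff (h : SymmForm P Q P' Q') (hP : P.Injective) (hQ : Q.Injective)
    (hx : x ∉ X) : IsTwin (ordRel P' Q') X u x ↔ IsTwin (ordRel P Q) X u x := by
  refine and_congr_right fun _ => forall₃_congr fun w hw hwu => ?_
  exact h.ordRel_eq_iff hP hQ (fun e => hx (e ▸ hw)) hwu

theorem SymmForm.isUniform_iff (h : SymmForm P Q P' Q') (hP : P.Injective) (hQ : Q.Injective)
    (hx : x ∉ X) : IsUniform (ordRel P' Q') X x ↔ IsUniform (ordRel P Q) X x := by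
  refine forall₄_congr fun a ha b hb => ?_
  exact h.ordRel_eq_iff hP hQ (fun e => hx (e ▸ ha)) (fun e => hx (e ▸ hb))

end PointSet

/-! ### Alternations -/

section Alternation

variable {V : Type*} {P Q : V → ℤ} {m : ℕ} {c : ℕ → V}

/-- The points `c 0, c 1, …, c (2 * m - 1)`, listed from bottom to top, form a parallel
alternation: the points with odd index lie to the left of those with even index, and each of the
two classes increases from left to right. -/
structure IsAlternation (P Q : V → ℤ) (m : ℕ) (c : ℕ → V) : Prop where
  val : ∀ i j, i < j → j < 2 * m → Q (c i) < Q (c j)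
  pos : ∀ i j, i < j → j < 2 * m → i % 2 = j % 2 → P (c i) < P (c j)
  odd_even : ∀ i j, i < 2 * m → j < 2 * m → i % 2 = 1 → j % 2 = 0 → P (c i) < P (c j)

/-- The set of points of an alternation. -/
def altSet (m : ℕ) (c : ℕ → V) : Set V := c '' Set.Iio (2 * m)

theorem mem_altSet {i : ℕ} (hi : i < 2 * m) : c i ∈ altSet m c := ⟨i, hi, rfl⟩

namespace IsAlternation

theorem ne (h : IsAlternation P Q m c) {i j : ℕ} (hi : i < 2 * m) (hj : j < 2 * m) (hij : i ≠ j) :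
    c i ≠ c j := by
  intro e
  rcases Nat.lt_or_gt_of_ne hij with h1 | h1
  · have := h.val i j h1 hj
    rw [e] at this
    exact lt_irrefl _ this
  · have := h.val j i h1 hi
    rw [e] at this
    exact lt_irrefl _ this

theorem val_iff (h : IsAlternation P Q m c) {i j : ℕ} (hi : i < 2 * m) (hj : j < 2 * m) :
    Q (c i) < Q (c j) ↔ i < j := by
  refine ⟨fun h1 => ?_, fun h1 => h.val i j h1 hj⟩
  by_contra h2
  rcases Nat.lt_or_eq_of_le (not_lt.mp h2) with h3 | rfl
  · exact lt_asymm h1 (h.val j i h3 hi)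
  · exact lt_irrefl _ h1

theorem ncard_altSet (h : IsAlternation P Q m c) : (altSet m c).ncard = 2 * m := by
  rw [altSet, Set.InjOn.ncard_image]
  · simp [Set.ncard_eq_toFinset_card']
  · intro i hi j hj e
    by_contra hne
    exact h.ne hi hj hne e

theorem exists_ne_ne (h : IsAlternation P Q m c) (hm : 2 ≤ m) (u v : V) :
    ∃ w ∈ altSet m c, w ≠ u ∧ w ≠ v := by
  have h01 := h.ne (i := 0) (j := 1) (by omega) (by omega) (by omega)
  have h02 := h.ne (i := 0) (j := 2) (by omega) (by omega) (by omega)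
  have h12 := h.ne (i := 1) (j := 2) (by omega) (by omega) (by omega)
  by_contra! hcon
  have h0 := hcon _ (mem_altSet (show 0 < 2 * m by omega))
  have h1 := hcon _ (mem_altSet (show 1 < 2 * m by omega))
  have h2 := hcon _ (mem_altSet (show 2 < 2 * m by omega))
  by_cases e0 : c 0 = u
  · have e1 := h1 fun e => h01 (e0.trans e.symm)
    have e2 := h2 fun e => h02 (e0.trans e.symm)
    exact h12 (e1.trans e2.symm)
  · by_cases e1 : c 1 = u
    · exact h02 ((h0 e0).trans (h2 fun e => h12 (e1.trans e.symm)).symm)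
    · exact h01 ((h0 e0).trans (h1 e1).symm)

/-- Turning the plane by half a turn gives an alternation, with the points in the reverse order. -/
theorem rotate (h : IsAlternation P Q m c) :
    IsAlternation (-P) (-Q) m (fun i => c (2 * m - 1 - i)) where
  val i j hij hj := by
    have := h.val (2 * m - 1 - j) (2 * m - 1 - i) (by omega) (by omega)
    simpa using this
  pos i j hij hj hp := by
    have := h.pos (2 * m - 1 - j) (2 * m - 1 - i) (by omega) (by omega) (by omega)
    simpa using this
  odd_even i j hi hj hi1 hj1 := by
    have := h.odd_even (2 * m - 1 - j) (2 * m - 1 - i) (by omega) (by omega) (by omega) (by omega)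
    simpa using this

theorem altSet_rotate : altSet m (fun i => c (2 * m - 1 - i)) = altSet m c := by
  ext v
  constructor
  · rintro ⟨i, hi, rfl⟩
    have : i < 2 * m := hi
    exact mem_altSet (by omega)
  · rintro ⟨i, hi, rfl⟩
    have : i < 2 * m := hi
    exact ⟨2 * m - 1 - i, show _ < 2 * m by omega,
      show c (2 * m - 1 - (2 * m - 1 - i)) = c i by congr 1; omega⟩

/-- Two consecutive points `c k`, `c (k + 1)` of a module force the leftmost even and rightmost odd
points into it, that is, the lowest and the highest point, and hence everything. -/
theorem isPrimeOn (h : IsAlternation P Q m c) (hP : P.Injective) (hQ : Q.Injective) :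
    IsPrimeOn (ordRel P Q) (altSet m c) := by
  intro M hM
  rw [isModule_ordRel_iff hP hQ] at hM
  obtain ⟨hsub, hconv⟩ := hM
  by_contra! hcon
  obtain ⟨hns, hne⟩ := hcon
  have key : ∀ i j, i < j → j < 2 * m → c i ∈ M → c j ∈ M → False := by
    intro i j hij hj hiM hjM
    have hi1 : c (i + 1) ∈ M := by
      rcases Nat.lt_or_eq_of_le (show i + 1 ≤ j from hij) with h1 | h1
      · exact (hconv _ (mem_altSet (by omega)) _ hiM _ hjM).2 (h.val _ _ (by omega) (by omega))
          (h.val _ _ h1 hj)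
      · rw [h1]
        exact hjM
    have hoe : ∃ o e, o < 2 * m ∧ e < 2 * m ∧ o % 2 = 1 ∧ e % 2 = 0 ∧ c o ∈ M ∧ c e ∈ M := by
      rcases Nat.mod_two_eq_zero_or_one i with h1 | h1
      · exact ⟨i + 1, i, by omega, by omega, by omega, h1, hi1, hiM⟩
      · exact ⟨i, i + 1, by omega, by omega, h1, by omega, hiM, hi1⟩
    obtain ⟨o, e, ho, he, ho1, he1, hoM, heM⟩ := hoe
    have hbot : c 0 ∈ M := by
      rcases Nat.eq_zero_or_pos e with rfl | h1
      · exact heM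
      · exact (hconv _ (mem_altSet (by omega)) _ hoM _ heM).1
          (h.odd_even _ _ ho (by omega) ho1 (by omega)) (h.pos _ _ h1 he (by omega))
    have htop : c (2 * m - 1) ∈ M := by
      rcases Nat.lt_or_eq_of_le (show o ≤ 2 * m - 1 by omega) with h1 | rfl
      · exact (hconv _ (mem_altSet (by omega)) _ hoM _ heM).1
          (h.pos _ _ h1 (by omega) (by omega))
          (h.odd_even _ _ (by omega) he (by omega) (by omega))
      · exact hoM
    refine hne (hsub.antisymm ?_)
    rintro _ ⟨k, hk, rfl⟩
    have hk : k < 2 * m := hk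
    rcases Nat.eq_zero_or_pos k with rfl | h1
    · exact hbot
    rcases Nat.lt_or_eq_of_le (show k ≤ 2 * m - 1 by omega) with h2 | rfl
    · exact (hconv _ (mem_altSet hk) _ hbot _ htop).2 (h.val _ _ h1 hk) (h.val _ _ h2 (by omega))
    · exact htop
  obtain ⟨a, ha, b, hb, hab⟩ := hns
  obtain ⟨i, hi, rfl⟩ := hsub ha
  obtain ⟨j, hj, rfl⟩ := hsub hb
  rcases lt_trichotomy i j with h1 | rfl | h1
  · exact key i j h1 hj ha hb
  · exact hab rfl
  · exact key j i h1 hi hb ha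

end IsAlternation

end Alternation

/-! ### Simple patterns of length five -/

section Five

variable {V : Type*} {P Q : V → ℤ}

/-- The pattern of length `k` whose points, read from bottom to top, have horizontal positions
`τ 0, τ 1, …` has no proper interval with at least two elements. Sets of positions are given by
their indicator functions. -/
def IsSimplePattern {k : ℕ} (τ : Fin k → Fin k) : Prop :=
  ∀ f : Fin k → Bool,
    (∀ i j l, f i = true → f j = true → i < l → l < j → f l = true) →
    (∀ i j l, f (τ i) = true → f (τ j) = true → i < l → l < j → f (τ l) = true) →
    (∀ i j, f i = true → f j = true → i = j) ∨ ∀ i, f i = true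

instance {k : ℕ} (τ : Fin k → Fin k) : Decidable (IsSimplePattern τ) :=
  Fintype.decidableForallFintype

theorem IsSimplePattern.isPrimeOn {k : ℕ} {τ : Fin k → Fin k} (hτ : IsSimplePattern τ)
    (hP : P.Injective) (hQ : Q.Injective) {g : Fin k → V} (hgP : StrictMono (P ∘ g))
    (hgQ : StrictMono (Q ∘ g ∘ τ)) : IsPrimeOn (ordRel P Q) (Set.range g) := by
  classical
  intro M hM
  rw [isModule_ordRel_iff hP hQ] at hM
  obtain ⟨hsub, hconv⟩ := hM
  rcases hτ (fun i => decide (g i ∈ M))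
    (fun i j l hi hj hil hlj => by
      simp only [decide_eq_true_eq] at *
      exact (hconv _ ⟨l, rfl⟩ _ hi _ hj).1 (hgP hil) (hgP hlj))
    (fun i j l hi hj hil hlj => by
      simp only [decide_eq_true_eq] at *
      exact (hconv _ ⟨τ l, rfl⟩ _ hi _ hj).2 (hgQ hil) (hgQ hlj)) with h | h
  · left
    intro a ha b hb
    obtain ⟨i, rfl⟩ := hsub ha
    obtain ⟨j, rfl⟩ := hsub hb
    rw [h i j (by simpa using ha) (by simpa using hb)]
  · right
    refine hsub.antisymm ?_
    rintro _ ⟨i, rfl⟩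
    simpa using h i

theorem isSimplePattern_five :
    IsSimplePattern ![(2 : Fin 5), 0, 4, 1, 3] ∧
    IsSimplePattern ![(3 : Fin 5), 0, 2, 4, 1] ∧
    IsSimplePattern ![(1 : Fin 5), 3, 0, 4, 2] ∧
    IsSimplePattern ![(2 : Fin 5), 4, 0, 3, 1] ∧
    IsSimplePattern ![(1 : Fin 5), 4, 2, 0, 3] ∧
    IsSimplePattern ![(3 : Fin 5), 1, 4, 0, 2] := by
  set_option maxRecDepth 100000 in decide

/-- Five points with a simple pattern form a prime set, as do an alternation; the two sizes have
different parities, so in a critical point set they exclude each other. -/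
theorem IsCritical.not_five [Finite V] {m : ℕ} {c : ℕ → V} (hP : P.Injective) (hQ : Q.Injective)
    (hV : IsCritical (ordRel P Q)) (hm : 2 ≤ m) (h : IsAlternation P Q m c) {τ : Fin 5 → Fin 5}
    (hτ : IsSimplePattern τ) (g : Fin 5 → V) (hgP : StrictMono (P ∘ g))
    (hgQ : StrictMono (Q ∘ g ∘ τ)) : False := by
  have hr := isReversible_ordRel hP hQ
  have hg : Function.Injective g := fun i j e => hgP.injective (congrArg P e)
  have h1 := hV.even_ncard_compl hr (h.isPrimeOn hP hQ) (h.exists_ne_ne hm)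
  have h2 := hV.even_ncard_compl hr (hτ.isPrimeOn hP hQ hgP hgQ) (fun u v => by
    have h01 := hg.ne (show (0 : Fin 5) ≠ 1 by decide)
    have h02 := hg.ne (show (0 : Fin 5) ≠ 2 by decide)
    have h12 := hg.ne (show (1 : Fin 5) ≠ 2 by decide)
    by_contra! hcon
    have k0 := hcon _ ⟨0, rfl⟩
    have k1 := hcon _ ⟨1, rfl⟩
    have k2 := hcon _ ⟨2, rfl⟩
    by_cases e0 : g 0 = u
    · exact h12 ((k1 fun e => h01 (e0.trans e.symm)).trans (k2 fun e => h02 (e0.trans e.symm)).symm)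
    · by_cases e1 : g 1 = u
      · exact h02 ((k0 e0).trans (k2 fun e => h12 (e1.trans e.symm)).symm)
      · exact h01 ((k0 e0).trans (k1 e1).symm))
  have h3 := Set.ncard_add_ncard_compl (altSet m c)
  have h4 := Set.ncard_add_ncard_compl (Set.range g)
  have h5 : (Set.range g).ncard = 5 := by
    rw [← Set.image_univ, Set.ncard_image_of_injective _ hg, Set.ncard_univ, Nat.card_fin]
  rw [h.ncard_altSet] at h3
  rw [h5] at h4
  obtain ⟨k, hk⟩ := h1
  obtain ⟨l, hl⟩ := h2
  omega

/-- None of the six simple permutations of length five is a pattern of the point set. -/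
structure AvoidsFive (P Q : V → ℤ) : Prop where
  not_24153 : ∀ a b c d e, P a < P b → P b < P c → P c < P d → P d < P e →
    Q c < Q a → Q a < Q e → Q e < Q b → Q b < Q d → False
  not_25314 : ∀ a b c d e, P a < P b → P b < P c → P c < P d → P d < P e →
    Q d < Q a → Q a < Q c → Q c < Q e → Q e < Q b → False
  not_31524 : ∀ a b c d e, P a < P b → P b < P c → P c < P d → P d < P e →
    Q b < Q d → Q d < Q a → Q a < Q e → Q e < Q c → False
  not_35142 : ∀ a b c d e, P a < P b → P b < P c → P c < P d → P d < P e →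
    Q c < Q e → Q e < Q a → Q a < Q d → Q d < Q b → False
  not_41352 : ∀ a b c d e, P a < P b → P b < P c → P c < P d → P d < P e →
    Q b < Q e → Q e < Q c → Q c < Q a → Q a < Q d → False
  not_42513 : ∀ a b c d e, P a < P b → P b < P c → P c < P d → P d < P e →
    Q d < Q b → Q b < Q e → Q e < Q a → Q a < Q c → False

theorem strictMono_comp_five {R : V → ℤ} {a b c d e : V} (h1 : R a < R b) (h2 : R b < R c)
    (h3 : R c < R d) (h4 : R d < R e) : StrictMono (R ∘ ![a, b, c, d, e]) := by
  rw [Fin.strictMono_iff_lt_succ]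
  intro i
  fin_cases i <;> assumption

theorem IsCritical.avoidsFive [Finite V] {m : ℕ} {c : ℕ → V} (hP : P.Injective)
    (hQ : Q.Injective) (hV : IsCritical (ordRel P Q)) (hm : 2 ≤ m) (h : IsAlternation P Q m c) :
    AvoidsFive P Q := by
  obtain ⟨t1, t2, t3, t4, t5, t6⟩ := isSimplePattern_five
  constructor
  · intro a b c d e p1 p2 p3 p4 q1 q2 q3 q4
    refine hV.not_five hP hQ hm h t1 ![a, b, c, d, e] (strictMono_comp_five p1 p2 p3 p4) ?_
    convert strictMono_comp_five q1 q2 q3 q4 using 1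
    funext i
    fin_cases i <;> rfl
  · intro a b c d e p1 p2 p3 p4 q1 q2 q3 q4
    refine hV.not_five hP hQ hm h t2 ![a, b, c, d, e] (strictMono_comp_five p1 p2 p3 p4) ?_
    convert strictMono_comp_five q1 q2 q3 q4 using 1
    funext i
    fin_cases i <;> rfl
  · intro a b c d e p1 p2 p3 p4 q1 q2 q3 q4
    refine hV.not_five hP hQ hm h t3 ![a, b, c, d, e] (strictMono_comp_five p1 p2 p3 p4) ?_
    convert strictMono_comp_five q1 q2 q3 q4 using 1
    funext i
    fin_cases i <;> rfl
  · intro a b c d e p1 p2 p3 p4 q1 q2 q3 q4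
    refine hV.not_five hP hQ hm h t4 ![a, b, c, d, e] (strictMono_comp_five p1 p2 p3 p4) ?_
    convert strictMono_comp_five q1 q2 q3 q4 using 1
    funext i
    fin_cases i <;> rfl
  · intro a b c d e p1 p2 p3 p4 q1 q2 q3 q4
    refine hV.not_five hP hQ hm h t5 ![a, b, c, d, e] (strictMono_comp_five p1 p2 p3 p4) ?_
    convert strictMono_comp_five q1 q2 q3 q4 using 1
    funext i
    fin_cases i <;> rfl
  · intro a b c d e p1 p2 p3 p4 q1 q2 q3 q4
    refine hV.not_five hP hQ hm h t6 ![a, b, c, d, e] (strictMono_comp_five p1 p2 p3 p4) ?_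
    convert strictMono_comp_five q1 q2 q3 q4 using 1
    funext i
    fin_cases i <;> rfl

end Five

/-! ### Configurations excluded by the patterns of length five -/

section Configurations

variable {V : Type*} {P Q : V → ℤ}

/-- The list of simple patterns of length five is closed under the half turn. -/
theorem AvoidsFive.rotate (hA : AvoidsFive P Q) : AvoidsFive (-P) (-Q) where
  not_24153 a b c d e p1 p2 p3 p4 q1 q2 q3 q4 := by
    simp only [Pi.neg_apply, neg_lt_neg_iff] at p1 p2 p3 p4 q1 q2 q3 q4
    exact hA.not_31524 e d c b a p4 p3 p2 p1 q4 q3 q2 q1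
  not_25314 a b c d e p1 p2 p3 p4 q1 q2 q3 q4 := by
    simp only [Pi.neg_apply, neg_lt_neg_iff] at p1 p2 p3 p4 q1 q2 q3 q4
    exact hA.not_25314 e d c b a p4 p3 p2 p1 q4 q3 q2 q1
  not_31524 a b c d e p1 p2 p3 p4 q1 q2 q3 q4 := by
    simp only [Pi.neg_apply, neg_lt_neg_iff] at p1 p2 p3 p4 q1 q2 q3 q4
    exact hA.not_24153 e d c b a p4 p3 p2 p1 q4 q3 q2 q1
  not_35142 a b c d e p1 p2 p3 p4 q1 q2 q3 q4 := by
    simp only [Pi.neg_apply, neg_lt_neg_iff] at p1 p2 p3 p4 q1 q2 q3 q4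
    exact hA.not_42513 e d c b a p4 p3 p2 p1 q4 q3 q2 q1
  not_41352 a b c d e p1 p2 p3 p4 q1 q2 q3 q4 := by
    simp only [Pi.neg_apply, neg_lt_neg_iff] at p1 p2 p3 p4 q1 q2 q3 q4
    exact hA.not_41352 e d c b a p4 p3 p2 p1 q4 q3 q2 q1
  not_42513 a b c d e p1 p2 p3 p4 q1 q2 q3 q4 := by
    simp only [Pi.neg_apply, neg_lt_neg_iff] at p1 p2 p3 p4 q1 q2 q3 q4
    exact hA.not_35142 e d c b a p4 p3 p2 p1 q4 q3 q2 q1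

/-- The points `w, u, v, z` are consecutive points of an alternation, with `u` on the left. If twins
`x` of `u` and `y` of `v` satisfy `u < y < x < v` in vertical order, then `x` lies to the right of
`u` and `y` to the left of `v`, as is needed for a longer alternation. -/
theorem AvoidsFive.insert_odd (hA : AvoidsFive P Q) {u v w x y z : V}
    (p1 : P u ≠ P x) (p2 : P y ≠ P v) (p3 : P u < P z) (p4 : P x < P z) (p5 : P z < P w)
    (p6 : P w < P y) (p7 : P w < P v) (q1 : Q w < Q u) (q2 : Q u < Q y) (q3 : Q y < Q x)
    (q4 : Q x < Q v) (q5 : Q v < Q z) : P u < P x ∧ P y < P v := by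
  rcases lt_or_gt_of_ne p1 with p1 | p1
  · rcases lt_or_gt_of_ne p2 with p2 | p2
    · exact ⟨by omega, by omega⟩
    · exact (hA.not_24153 u x w v y (by omega) (by omega) (by omega) (by omega)
        (by omega) (by omega) (by omega) (by omega)).elim
  · exact (hA.not_42513 x u z w y (by omega) (by omega) (by omega) (by omega)
      (by omega) (by omega) (by omega) (by omega)).elim

/-- As `insert_odd`, for consecutive points `u, v, z, t` with `u` on the right. -/
theorem AvoidsFive.insert_even (hA : AvoidsFive P Q) {t u v x y z : V}
    (p1 : P y ≠ P v) (p2 : P u ≠ P x) (p3 : P y < P t) (p4 : P t < P u) (p5 : P t < P x)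
    (p6 : P u < P z) (p7 : P x < P z) (q1 : Q u < Q y) (q2 : Q y < Q x) (q3 : Q x < Q v)
    (q4 : Q v < Q z) (q5 : Q z < Q t) : P u < P x ∧ P y < P v := by
  rcases lt_or_gt_of_ne p1 with p1 | p1
  · rcases lt_or_gt_of_ne p2 with p2 | p2
    · exact ⟨by omega, by omega⟩
    · exact (hA.not_25314 y t x u z (by omega) (by omega) (by omega) (by omega)
        (by omega) (by omega) (by omega) (by omega)).elim
  · rcases lt_or_gt_of_ne p2 with p2 | p2
    · exact (hA.not_42513 v y t u x (by omega) (by omega) (by omega) (by omega)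
        (by omega) (by omega) (by omega) (by omega)).elim
    · exact (hA.not_31524 v y t x z (by omega) (by omega) (by omega) (by omega)
        (by omega) (by omega) (by omega) (by omega)).elim

/-- As `insert_odd`, for consecutive points `p, q, u, v` with `u` on the right. -/
theorem AvoidsFive.insert_even_top (hA : AvoidsFive P Q) {p q u v x y : V}
    (p1 : P y ≠ P v) (p2 : P u ≠ P x) (p3 : P q < P y) (p4 : P q < P v) (p5 : P y < P p)
    (p6 : P p < P x) (q1 : Q p < Q q) (q2 : Q q < Q u) (q3 : Q u < Q y) (q4 : Q y < Q x)
    (q5 : Q x < Q v) : P u < P x ∧ P y < P v := by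
  rcases lt_or_gt_of_ne p1 with p1 | p1
  · rcases lt_or_gt_of_ne p2 with p2 | p2
    · exact ⟨by omega, by omega⟩
    · exact (hA.not_24153 q y p x u (by omega) (by omega) (by omega) (by omega)
        (by omega) (by omega) (by omega) (by omega)).elim
  · exact (hA.not_25314 q v y p x (by omega) (by omega) (by omega) (by omega)
      (by omega) (by omega) (by omega) (by omega)).elim

/-- The points `u, a, c, b` are the four lowest ones of an alternation, `x` is a twin of `u` below
it, and `y`, on the left of everything, separates `x` from `u`. Then `x` lies to the left of `u`. -/
theorem AvoidsFive.prepend_left (hA : AvoidsFive P Q) {a b c u x y : V}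
    (p1 : P u ≠ P x) (p2 : P y < P a) (p3 : P a < P b) (p4 : P b < P u) (p5 : P x < P c)
    (q1 : Q x < Q y) (q2 : Q y < Q u) (q3 : Q u < Q a) (q4 : Q a < Q c) (q5 : Q c < Q b) :
    P x < P u := by
  rcases lt_or_gt_of_ne p1 with p1 | p1
  · exact (hA.not_25314 y b u x c (by omega) (by omega) (by omega) (by omega)
      (by omega) (by omega) (by omega) (by omega)).elim
  · exact p1

/-- As `prepend_left`, but with `y` on the right of everything; this is impossible. -/
theorem AvoidsFive.prepend_right (hA : AvoidsFive P Q) {a b c u x y : V}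
    (p1 : P a < P b) (p2 : P b < P x) (p3 : P x < P c) (p4 : P c < P y) (q1 : Q x < Q y)
    (q2 : Q y < Q u) (q3 : Q u < Q a) (q4 : Q a < Q c) (q5 : Q c < Q b) : False := by
  exact hA.not_35142 a b x c y (by omega) (by omega) (by omega) (by omega)
    (by omega) (by omega) (by omega) (by omega)

/-- The points `s, u, w, v, t, r` are consecutive points of an alternation, with `u` on the left. No
twins `x` of `u` and `y` of `v` satisfy `u < y < x < v` in horizontal order. -/
theorem AvoidsFive.gap_odd_low (hA : AvoidsFive P Q) {r s t u v w x y : V}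
    (p1 : P u < P y) (p2 : P y < P x) (p3 : P x < P v) (p4 : P v < P r) (p5 : P r < P s)
    (p6 : P s < P w) (q1 : Q u ≠ Q x) (q2 : Q y ≠ Q v) (q3 : Q s < Q u) (q4 : Q u < Q w)
    (q5 : Q x < Q w) (q6 : Q w < Q y) (q7 : Q y < Q t) (q8 : Q t < Q r) : False := by
  rcases lt_or_gt_of_ne q1 with q1 | q1
  · exact hA.not_25314 u y x s w (by omega) (by omega) (by omega) (by omega)
      (by omega) (by omega) (by omega) (by omega)
  · rcases lt_or_gt_of_ne q2 with q2 | q2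
    · exact hA.not_24153 u y x v w (by omega) (by omega) (by omega) (by omega)
        (by omega) (by omega) (by omega) (by omega)
    · exact hA.not_24153 u y x r w (by omega) (by omega) (by omega) (by omega)
        (by omega) (by omega) (by omega) (by omega)

/-- As `gap_odd_low`, for consecutive points `e, l, s, u, w, v` of an alternation. -/
theorem AvoidsFive.gap_odd_high (hA : AvoidsFive P Q) {e l s u v w x y : V}
    (p1 : P l < P u) (p2 : P u < P y) (p3 : P y < P x) (p4 : P x < P v) (p5 : P v < P e)
    (p6 : P e < P s) (p7 : P s < P w) (q1 : Q e < Q l) (q2 : Q l < Q s) (q3 : Q s < Q x)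
    (q4 : Q x < Q w) (q5 : Q w < Q y) : False := by
  exact hA.not_25314 l y x e w (by omega) (by omega) (by omega) (by omega)
    (by omega) (by omega) (by omega) (by omega)

/-- As `gap_odd_low`, where `u` is the highest and `v` the lowest point of an alternation, `a, c, b`
are the next lowest ones, and `g` is the next highest one. -/
theorem AvoidsFive.gap_middle (hA : AvoidsFive P Q) {a b c g u v x y : V}
    (p1 : P a < P b) (p2 : P b < P u) (p3 : P u < P y) (p4 : P y < P x) (p5 : P x < P v)
    (p6 : P v < P c) (q1 : Q y < Q a) (q2 : Q a < Q c) (q3 : Q c < Q b) (q4 : Q b < Q g)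
    (q5 : Q g < Q x) : False := by
  exact hA.not_24153 a b y x c (by omega) (by omega) (by omega) (by omega)
    (by omega) (by omega) (by omega) (by omega)

/-- The points `a, u, c, b, e, d` are the lowest ones of an alternation. No twin `x` of the leftmost
point `u` lies to the left of `u` and is separated from it by a point `y` above everything. -/
theorem AvoidsFive.before_first_top (hA : AvoidsFive P Q) {a b c d e u x y : V}
    (p1 : P x < P y) (p2 : P y < P u) (p3 : P u < P b) (p4 : P b < P d) (p5 : P d < P a)
    (p6 : P a < P c) (p7 : P c < P e) (q1 : Q u ≠ Q x) (q2 : Q a < Q x) (q3 : Q u < Q c)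
    (q4 : Q x < Q c) (q5 : Q c < Q b) (q6 : Q b < Q e) (q7 : Q e < Q d) (q8 : Q d < Q y) :
    False := by
  rcases lt_or_gt_of_ne q1 with q1 | q1
  · exact hA.not_25314 x y b a e (by omega) (by omega) (by omega) (by omega)
      (by omega) (by omega) (by omega) (by omega)
  · exact hA.not_25314 x y u a c (by omega) (by omega) (by omega) (by omega)
      (by omega) (by omega) (by omega) (by omega)

/-- As `before_first_top`, with `y` below everything. -/
theorem AvoidsFive.before_first_bottom (hA : AvoidsFive P Q) {a b c d u x y : V}
    (p1 : P x < P y) (p2 : P y < P u) (p3 : P u < P b) (p4 : P b < P d) (p5 : P d < P a)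
    (p6 : P a < P c) (q1 : Q u ≠ Q x) (q2 : Q y < Q a) (q3 : Q a < Q u) (q4 : Q a < Q x)
    (q5 : Q x < Q c) (q6 : Q c < Q b) : False := by
  rcases lt_or_gt_of_ne q1 with q1 | q1
  · exact hA.not_41352 x y u b a (by omega) (by omega) (by omega) (by omega)
      (by omega) (by omega) (by omega) (by omega)
  · exact hA.not_31524 x y b a c (by omega) (by omega) (by omega) (by omega)
      (by omega) (by omega) (by omega) (by omega)

end Configurations

/-! ### Inserting two points into an alternation -/

section Enlarge

variable {V : Type*} {P Q : V → ℤ} {m : ℕ} {c : ℕ → V} {x y : V}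

/-- Two points inserted between `c i` and `c (i + 1)`, the lower one next to `c (i + 1)` on its
left and the upper one next to `c i` on its right, give a longer alternation. -/
theorem IsAlternation.exists_of_insert (h : IsAlternation P Q m c) {i : ℕ} (hi : i + 1 < 2 * m)
    (q1 : Q (c i) < Q y) (q2 : Q y < Q x) (q3 : Q x < Q (c (i + 1)))
    (x1 : ∀ j < 2 * m, P (c j) < P (c i) → P (c j) < P x)
    (x2 : ∀ j < 2 * m, P (c i) < P (c j) → P x < P (c j))
    (y1 : ∀ j < 2 * m, P (c j) < P (c (i + 1)) → P (c j) < P y)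
    (y2 : ∀ j < 2 * m, P (c (i + 1)) < P (c j) → P y < P (c j))
    (px : P (c i) < P x) (py : P y < P (c (i + 1)))
    (odd : i % 2 = 1 → P x < P y) (even : i % 2 = 0 → P y < P x) :
    ∃ c', IsAlternation P Q (m + 1) c' := by
  obtain ⟨c', hc'⟩ : ∃ c' : ℕ → V, ∀ j, (j ≤ i ∧ c' j = c j) ∨ (j = i + 1 ∧ c' j = y) ∨
      (j = i + 2 ∧ c' j = x) ∨ (i + 3 ≤ j ∧ c' j = c (j - 2)) := by
    refine ⟨fun j => if j ≤ i then c j else if j = i + 1 then y else if j = i + 2 then x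
      else c (j - 2), fun j => ?_⟩
    dsimp only
    split_ifs with h1 h2 h3
    · exact Or.inl ⟨h1, rfl⟩
    · exact Or.inr (Or.inl ⟨h2, rfl⟩)
    · exact Or.inr (Or.inr (Or.inl ⟨h3, rfl⟩))
    · exact Or.inr (Or.inr (Or.inr ⟨by omega, rfl⟩))
  have lo : ∀ j, j ≤ i → Q (c j) ≤ Q (c i) := fun j hj => by
    rcases Nat.lt_or_eq_of_le hj with h1 | rfl
    · exact (h.val j i h1 (by omega)).le
    · exact le_rfl
  have hi' : ∀ j, i + 1 ≤ j → j < 2 * m → Q (c (i + 1)) ≤ Q (c j) := fun j hj hjm => by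
    rcases Nat.lt_or_eq_of_le hj with h1 | rfl
    · exact (h.val (i + 1) j h1 hjm).le
    · exact le_rfl
  have old : ∀ j k, j < 2 * m → k < 2 * m → (j < k ∧ j % 2 = k % 2 ∨ j % 2 = 1 ∧ k % 2 = 0) →
      P (c j) < P (c k) := by
    rintro j k hj hk (⟨h1, h2⟩ | ⟨h1, h2⟩)
    · exact h.pos j k h1 hk h2
    · exact h.odd_even j k hj hk h1 h2
  have new : ∀ j k, j < 2 * (m + 1) → k < 2 * (m + 1) →
      (j < k ∧ j % 2 = k % 2 ∨ j % 2 = 1 ∧ k % 2 = 0) → P (c' j) < P (c' k) := by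
    intro j k hj hk hjk
    rcases hc' j with ⟨hj1, ej⟩ | ⟨hj1, ej⟩ | ⟨hj1, ej⟩ | ⟨hj1, ej⟩ <;>
      rcases hc' k with ⟨hk1, ek⟩ | ⟨hk1, ek⟩ | ⟨hk1, ek⟩ | ⟨hk1, ek⟩ <;> rw [ej, ek]
    · exact old _ _ (by omega) (by omega) (by omega)
    · exact y1 _ (by omega) (old _ _ (by omega) hi (by omega))
    · rcases Nat.lt_or_eq_of_le hj1 with h1 | rfl
      · exact x1 _ (by omega) (old _ _ (by omega) (by omega) (by omega))
      · exact px
    · exact old _ _ (by omega) (by omega) (by omega)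
    · exact y2 _ (by omega) (old _ _ (by omega) (by omega) (by omega))
    · omega
    · exact even (by omega)
    · rcases Nat.lt_or_eq_of_le hk1 with h1 | rfl
      · exact y2 _ (by omega) (old _ _ (by omega) (by omega) (by omega))
      · exact py
    · exact x2 _ (by omega) (old _ _ (by omega) (by omega) (by omega))
    · exact odd (by omega)
    · omega
    · exact x2 _ (by omega) (old _ _ (by omega) (by omega) (by omega))
    · exact old _ _ (by omega) (by omega) (by omega)
    · rcases Nat.lt_or_eq_of_le hj1 with h1 | rfl
      · exact y1 _ (by omega) (old _ _ (by omega) (by omega) (by omega))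
      · omega
    · exact x1 _ (by omega) (old _ _ (by omega) (by omega) (by omega))
    · exact old _ _ (by omega) (by omega) (by omega)
  refine ⟨c', ⟨fun j k hjk hk => ?_, fun j k hjk hk hp => new j k (by omega) hk (Or.inl ⟨hjk, hp⟩),
    fun j k hj hk h1 h2 => new j k hj hk (Or.inr ⟨h1, h2⟩)⟩⟩
  rcases hc' j with ⟨hj1, ej⟩ | ⟨hj1, ej⟩ | ⟨hj1, ej⟩ | ⟨hj1, ej⟩ <;>
    rcases hc' k with ⟨hk1, ek⟩ | ⟨hk1, ek⟩ | ⟨hk1, ek⟩ | ⟨hk1, ek⟩ <;> rw [ej, ek] <;>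
    first
    | omega
    | exact h.val _ _ (by omega) (by omega)
    | (have := lo j (by omega); omega)
    | (have := hi' (k - 2) (by omega) (by omega); omega)

/-- Two points put below an alternation, the lower one next to `c 0` on its left and the upper one
on the left of everything, give a longer alternation. -/
theorem IsAlternation.exists_of_prepend (h : IsAlternation P Q m c) (hm : 0 < m)
    (q1 : Q x < Q y) (q2 : Q y < Q (c 0)) (x1 : ∀ j < 2 * m, P (c j) < P (c 0) → P (c j) < P x)
    (px : P x < P (c 0)) (py : ∀ j < 2 * m, P y < P (c j)) (pyx : P y < P x) :
    ∃ c', IsAlternation P Q (m + 1) c' := by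
  obtain ⟨c', hc'⟩ : ∃ c' : ℕ → V, ∀ j, (j = 0 ∧ c' j = x) ∨ (j = 1 ∧ c' j = y) ∨
      (2 ≤ j ∧ c' j = c (j - 2)) := by
    refine ⟨fun j => if j = 0 then x else if j = 1 then y else c (j - 2), fun j => ?_⟩
    dsimp only
    split_ifs with h1 h2
    · exact Or.inl ⟨h1, rfl⟩
    · exact Or.inr (Or.inl ⟨h2, rfl⟩)
    · exact Or.inr (Or.inr ⟨by omega, rfl⟩)
  have lo : ∀ j, j < 2 * m → Q (c 0) ≤ Q (c j) := fun j hj => by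
    rcases Nat.eq_zero_or_pos j with rfl | h1
    · exact le_rfl
    · exact (h.val 0 j h1 hj).le
  have ev : ∀ j, j < 2 * m → j % 2 = 0 → P (c 0) ≤ P (c j) := fun j hj hj0 => by
    rcases Nat.eq_zero_or_pos j with rfl | h1
    · exact le_rfl
    · exact (h.pos 0 j h1 hj (by omega)).le
  refine ⟨c', ⟨fun j k hjk hk => ?_, fun j k hjk hk hp => ?_, fun j k hj hk h1 h2 => ?_⟩⟩
  · rcases hc' j with ⟨hj1, ej⟩ | ⟨hj1, ej⟩ | ⟨hj1, ej⟩ <;>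
      rcases hc' k with ⟨hk1, ek⟩ | ⟨hk1, ek⟩ | ⟨hk1, ek⟩ <;> rw [ej, ek] <;>
      first
      | omega
      | exact h.val _ _ (by omega) (by omega)
      | (have := lo (k - 2) (by omega); omega)
  · rcases hc' j with ⟨hj1, ej⟩ | ⟨hj1, ej⟩ | ⟨hj1, ej⟩ <;>
      rcases hc' k with ⟨hk1, ek⟩ | ⟨hk1, ek⟩ | ⟨hk1, ek⟩ <;> rw [ej, ek] <;>
      first
      | omega
      | exact h.pos _ _ (by omega) (by omega) (by omega)
      | exact py _ (by omega)
      | exact px.trans_le (ev _ (by omega) (by omega))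
  · rcases hc' j with ⟨hj1, ej⟩ | ⟨hj1, ej⟩ | ⟨hj1, ej⟩ <;>
      rcases hc' k with ⟨hk1, ek⟩ | ⟨hk1, ek⟩ | ⟨hk1, ek⟩ <;> rw [ej, ek] <;>
      first
      | omega
      | exact h.odd_even _ _ (by omega) (by omega) (by omega) (by omega)
      | exact py _ (by omega)
      | exact x1 _ (by omega) (h.odd_even _ _ (by omega) (by omega) (by omega) (by omega))

end Enlarge

/-! ### The two points added to a prime set -/

section TwoPoints

variable {V C : Type*} {r : V → V → C} {X : Set V} {u x y : V}

/-- If `x` is a twin of `u` and adding `x` and `y` to `X` gives a prime set, then `y` tells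
`u` from `x`. -/
theorem IsPrimeOn.ne_of_isTwin (h : IsPrimeOn r (insert x (insert y X)))
    (h3 : ∀ u v, ∃ w ∈ X, w ≠ u ∧ w ≠ v) (hx : x ∉ X) (hu : IsTwin r X u x) : r y u ≠ r y x := by
  intro e
  have hmod : IsModule r (insert x (insert y X)) {u, x} := by
    refine ⟨?_, fun z hz hzM => ?_⟩
    · rintro a (rfl | rfl)
      · exact Or.inr (Or.inr hu.1)
      · exact Or.inl rfl
    · have key : r z u = r z x := by
        rcases hz with rfl | rfl | hz
        · exact absurd (Or.inr rfl) hzM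
        · exact e
        · exact (hu.2 z hz fun e => hzM (Or.inl e)).symm
      rintro a (rfl | rfl) b (rfl | rfl) <;> simp [key]
  rcases h _ hmod with h1 | h1
  · exact hx (h1 (Or.inl rfl) (Or.inr rfl) ▸ hu.1)
  · obtain ⟨w, hw, hwu, -⟩ := h3 u u
    have : w ∈ ({u, x} : Set V) := by
      rw [h1]
      exact Or.inr (Or.inr hw)
    rcases this with rfl | rfl
    · exact hwu rfl
    · exact hx hw

theorem IsPrimeOn.not_isTwin_isTwin (h : IsPrimeOn r (insert x (insert y X)))
    (h3 : ∀ u v, ∃ w ∈ X, w ≠ u ∧ w ≠ v) (hx : x ∉ X) (hy : y ∉ X) (hu : IsTwin r X u x)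
    (hu' : IsTwin r X u y) : False := by
  have hmod : IsModule r (insert x (insert y X)) {u, x, y} := by
    refine ⟨?_, fun z hz hzM => ?_⟩
    · rintro a (rfl | rfl | rfl)
      · exact Or.inr (Or.inr hu.1)
      · exact Or.inl rfl
      · exact Or.inr (Or.inl rfl)
    · have key : r z x = r z u ∧ r z y = r z u := by
        rcases hz with rfl | rfl | hz
        · exact absurd (Or.inr (Or.inl rfl)) hzM
        · exact absurd (Or.inr (Or.inr rfl)) hzM
        · exact ⟨hu.2 z hz fun e => hzM (Or.inl e), hu'.2 z hz fun e => hzM (Or.inl e)⟩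
      rintro a (rfl | rfl | rfl) b (rfl | rfl | rfl) <;> simp [key]
  rcases h _ hmod with h1 | h1
  · exact hx (h1 (Or.inl rfl) (Or.inr (Or.inl rfl)) ▸ hu.1)
  · obtain ⟨w, hw, hwu, -⟩ := h3 u u
    have : w ∈ ({u, x, y} : Set V) := by
      rw [h1]
      exact Or.inr (Or.inr hw)
    rcases this with rfl | rfl | rfl
    · exact hwu rfl
    · exact hx hw
    · exact hy hw

theorem IsPrimeOn.not_isUniform_isUniform (h : IsPrimeOn r (insert x (insert y X)))
    (h3 : ∀ u v, ∃ w ∈ X, w ≠ u ∧ w ≠ v) (hx : x ∉ X) (hux : IsUniform r X x)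
    (huy : IsUniform r X y) : False := by
  have hmod : IsModule r (insert x (insert y X)) X := by
    refine ⟨fun a ha => Or.inr (Or.inr ha), fun z hz hzM => ?_⟩
    rcases hz with rfl | rfl | hz
    · exact hux
    · exact huy
    · exact absurd hz hzM
  rcases h _ hmod with h1 | h1
  · obtain ⟨a, ha, -⟩ := h3 x x
    obtain ⟨b, hb, hba, -⟩ := h3 a a
    exact hba (h1 hb ha)
  · exact hx (h1 ▸ Or.inl rfl)

end TwoPoints

/-! ### Enlarging an alternation inside a critical point set -/

section Enlarge

variable {V : Type*} {P Q : V → ℤ} {X : Set V} {u v w x y : V} {m : ℕ} {c : ℕ → V} {i j k : ℕ}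

theorem IsTwin.compare (hP : P.Injective) (hQ : Q.Injective) (hx : x ∉ X)
    (h : IsTwin (ordRel P Q) X u x) (hw : w ∈ X) (hwu : w ≠ u) :
    ((P w < P x ↔ P w < P u) ∧ (P x < P w ↔ P u < P w)) ∧
      (Q w < Q x ↔ Q w < Q u) ∧ (Q x < Q w ↔ Q u < Q w) := by
  have h1 := ordRel_eq_iff.mp (h.2 w hw hwu)
  have hwx : w ≠ x := fun e => hx (e ▸ hw)
  have h2 := hP.ne hwu
  have h3 := hQ.ne hwu
  have h4 := hP.ne hwx
  have h5 := hQ.ne hwx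
  omega

theorem IsAlternation.twin_compare (h : IsAlternation P Q m c) (hP : P.Injective)
    (hQ : Q.Injective) (hx : x ∉ altSet m c) (hi : i < 2 * m)
    (ht : IsTwin (ordRel P Q) (altSet m c) (c i) x) (hj : j < 2 * m) (hji : j ≠ i) :
    ((P (c j) < P x ↔ P (c j) < P (c i)) ∧ (P x < P (c j) ↔ P (c i) < P (c j))) ∧
      (Q (c j) < Q x ↔ Q (c j) < Q (c i)) ∧ (Q x < Q (c j) ↔ Q (c i) < Q (c j)) :=
  ht.compare hP hQ hx (mem_altSet hj) (h.ne hj hi hji)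

/-- Where twins `x` of `u` and `y` of `v` are vertically separated, the four points are adjacent
to one another in vertical order. -/
theorem IsTwin.val_order (hP : P.Injective) (hQ : Q.Injective) (hx : x ∉ X) (hy : y ∉ X)
    (hxy : x ≠ y) (huv : u ≠ v) (hu : IsTwin (ordRel P Q) X u x)
    (hv : IsTwin (ordRel P Q) X v y)
    (hs : ¬ (Q y < Q u ↔ Q y < Q x)) :
    (Q u < Q y ∧ Q y < Q x ∧ Q x < Q v) ∨ (Q v < Q x ∧ Q x < Q y ∧ Q y < Q u) := by
  have h1 := hu.compare hP hQ hx hv.1 huv.symm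
  have h2 := hv.compare hP hQ hy hu.1 huv
  have h3 := hQ.ne (show y ≠ u from fun e => hy (e ▸ hu.1))
  have h4 := hQ.ne (show v ≠ x from fun e => hx (e ▸ hv.1))
  have h5 := hQ.ne huv
  have h6 := hQ.ne hxy
  rw [not_iff] at hs
  omega

/-- The two new points are inserted between `c i` and `c j`, which are consecutive because twins of
`c i` and `c j` are not separated from these by any other point of the alternation. -/
theorem IsAlternation.enlarge_of_twins_of_lt (h : IsAlternation P Q m c) (hm : 2 ≤ m)
    (hP : P.Injective) (hQ : Q.Injective) (hA : AvoidsFive P Q) (hx : x ∉ altSet m c)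
    (hy : y ∉ altSet m c) (hi : i < 2 * m) (hj : j < 2 * m)
    (hu : IsTwin (ordRel P Q) (altSet m c) (c i) x)
    (hv : IsTwin (ordRel P Q) (altSet m c) (c j) y)
    (h1 : Q (c i) < Q y) (h2 : Q y < Q x) (h3 : Q x < Q (c j)) :
    ∃ c', IsAlternation P Q (m + 1) c' := by
  have hij : i < j := (h.val_iff hi hj).mp (by omega)
  have fx := fun k (hk : k < 2 * m) => h.twin_compare hP hQ hx hi hu hk
  have fy := fun k (hk : k < 2 * m) => h.twin_compare hP hQ hy hj hv hk
  obtain rfl : j = i + 1 := by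
    by_contra hne
    have h4 := (fx (i + 1) (by omega) (by omega)).2.2.mpr (h.val i (i + 1) (by omega) (by omega))
    have h5 := (fy (i + 1) (by omega) (by omega)).2.1.mpr (h.val (i + 1) j (by omega) hj)
    omega
  have nx : P (c i) ≠ P x := hP.ne fun e => hx (e ▸ mem_altSet hi)
  have ny : P y ≠ P (c (i + 1)) := hP.ne fun e => hy (e ▸ mem_altSet hj)
  have key : P (c i) < P x ∧ P y < P (c (i + 1)) := by
    rcases Nat.mod_two_eq_zero_or_one i with hp | hp
    · rcases Nat.lt_or_ge (i + 3) (2 * m) with h4 | h4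
      · have t1 := h.pos (i + 1) (i + 3) (by omega) h4 (by omega)
        have t2 := h.odd_even (i + 3) i h4 hi (by omega) hp
        have t3 := h.pos i (i + 2) (by omega) (by omega) (by omega)
        exact hA.insert_even (t := c (i + 3)) (z := c (i + 2)) ny nx
          ((fy _ h4 (by omega)).1.2.mpr t1) t2 ((fx _ h4 (by omega)).1.1.mpr t2) t3
          ((fx _ (by omega) (by omega)).1.2.mpr t3) h1 h2 h3
          (h.val _ _ (by omega) (by omega)) (h.val _ _ (by omega) h4)
      · have t1 := h.pos (i - 1) (i + 1) (by omega) hj (by omega)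
        have t2 := h.odd_even (i + 1) (i - 2) hj (by omega) (by omega) (by omega)
        have t3 := h.pos (i - 2) i (by omega) hi (by omega)
        exact hA.insert_even_top (q := c (i - 1)) (p := c (i - 2)) ny nx
          ((fy _ (by omega) (by omega)).1.1.mpr t1) t1 ((fy _ (by omega) (by omega)).1.2.mpr t2)
          ((fx _ (by omega) (by omega)).1.1.mpr t3) (h.val _ _ (by omega) (by omega))
          (h.val _ _ (by omega) (by omega)) h1 h2 h3
    · have t1 := h.pos i (i + 2) (by omega) (by omega) (by omega)
      have t2 := h.pos (i - 1) (i + 1) (by omega) hj (by omega)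
      exact hA.insert_odd (w := c (i - 1)) (z := c (i + 2)) nx ny t1
        ((fx _ (by omega) (by omega)).1.2.mpr t1)
        (h.odd_even _ _ (by omega) (by omega) (by omega) (by omega))
        ((fy _ (by omega) (by omega)).1.1.mpr t2) t2 (h.val _ _ (by omega) (by omega)) h1 h2 h3
        (h.val _ _ (by omega) (by omega))
  have ne_of_lt : ∀ {a b}, P (c a) < P (c b) → a ≠ b := fun hab e => by
    rw [e] at hab
    exact lt_irrefl _ hab
  refine h.exists_of_insert hj h1 h2 h3
    (fun k hk hlt => (fx k hk (ne_of_lt hlt)).1.1.mpr hlt)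
    (fun k hk hlt => (fx k hk (ne_of_lt hlt).symm).1.2.mpr hlt)
    (fun k hk hlt => (fy k hk (ne_of_lt hlt)).1.1.mpr hlt)
    (fun k hk hlt => (fy k hk (ne_of_lt hlt).symm).1.2.mpr hlt) key.1 key.2
    (fun hp => ?_) (fun hp => ?_)
  · -- the point `c (i + 2)` lies between `x` and `y`
    have t1 := (fx (i + 2) (by omega) (by omega)).1.2.mpr
      (h.pos i (i + 2) (by omega) (by omega) (by omega))
    have t2 := (fy (i + 2) (by omega) (by omega)).1.1.mpr
      (h.odd_even (i + 2) (i + 1) (by omega) (by omega) (by omega) (by omega))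
    omega
  · have := h.odd_even (i + 1) i hj hi (by omega) hp
    omega

/-- Vertically separated twins of two points of an alternation enlarge it. -/
theorem IsAlternation.enlarge_of_twins (h : IsAlternation P Q m c) (hm : 2 ≤ m)
    (hP : P.Injective) (hQ : Q.Injective) (hA : AvoidsFive P Q) (hx : x ∉ altSet m c)
    (hy : y ∉ altSet m c) (hxy : x ≠ y) (huv : u ≠ v)
    (hu : IsTwin (ordRel P Q) (altSet m c) u x)
    (hv : IsTwin (ordRel P Q) (altSet m c) v y) (hs : ¬ (Q y < Q u ↔ Q y < Q x)) :
    ∃ c', IsAlternation P Q (m + 1) c' := by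
  have h1 := IsTwin.val_order hP hQ hx hy hxy huv hu hv hs
  obtain ⟨i, hi, rfl⟩ := hu.1
  obtain ⟨j, hj, rfl⟩ := hv.1
  rcases h1 with ⟨h1, h2, h3⟩ | ⟨h1, h2, h3⟩
  · exact h.enlarge_of_twins_of_lt hm hP hQ hA hx hy hi hj hu hv h1 h2 h3
  · exact h.enlarge_of_twins_of_lt hm hP hQ hA hy hx hj hi hv hu h1 h2 h3

theorem IsAlternation.uniform_compare (hy : IsUniform (ordRel P Q) (altSet m c) y)
    (hj : j < 2 * m) (hk : k < 2 * m) :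
    (P y < P (c j) ↔ P y < P (c k)) ∧ (Q y < Q (c j) ↔ Q y < Q (c k)) :=
  ordRel_eq_iff.mp (hy _ (mem_altSet hj) _ (mem_altSet hk))

/-- The point `u` is the lowest one, `c 0`, because any lower point of the alternation would be
below `x` and hence below `y`. The two new points are put below `c 0`. -/
theorem IsAlternation.enlarge_of_uniform_of_lt (h : IsAlternation P Q m c) (hm : 2 ≤ m)
    (hP : P.Injective) (hQ : Q.Injective) (hA : AvoidsFive P Q) (hx : x ∉ altSet m c)
    (hy : y ∉ altSet m c) (hu : IsTwin (ordRel P Q) (altSet m c) u x)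
    (hyu : IsUniform (ordRel P Q) (altSet m c) y) (h1 : Q x < Q y) (h2 : Q y < Q u) :
    ∃ c', IsAlternation P Q (m + 1) c' := by
  obtain ⟨i, hi, rfl⟩ := hu.1
  have hi : i < 2 * m := hi
  have fx := fun k (hk : k < 2 * m) => h.twin_compare hP hQ hx hi hu hk
  have gy := fun k (hk : k < 2 * m) => IsAlternation.uniform_compare hyu hk hi
  have ny := fun k (hk : k < 2 * m) => hP.ne fun e : y = c k => hy (e ▸ mem_altSet hk)
  obtain rfl : i = 0 := by
    by_contra hne
    have t1 := (fx 0 (by omega) (Ne.symm hne)).2.1.mpr (h.val 0 i (by omega) hi)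
    have t2 := (gy 0 (by omega)).2.mpr h2
    omega
  have nx : P (c 0) ≠ P x := hP.ne fun e => hx (e ▸ mem_altSet hi)
  have t1 := h.pos 1 3 (by omega) (by omega) rfl
  have t2 := h.odd_even 3 0 (by omega) (by omega) rfl rfl
  have t3 := h.pos 0 2 (by omega) (by omega) rfl
  have t4 := (fx 3 (by omega) (by omega)).1.1.mpr t2
  have t5 := (fx 2 (by omega) (by omega)).1.2.mpr t3
  have v1 := h.val 0 1 (by omega) (by omega)
  have v2 := h.val 1 2 (by omega) (by omega)
  have v3 := h.val 2 3 (by omega) (by omega)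
  rcases lt_or_gt_of_ne (ny 0 hi) with hy0 | hy0
  · have hall : ∀ k < 2 * m, P y < P (c k) := fun k hk => (gy k hk).1.mpr hy0
    have px := hA.prepend_left nx (hall 1 (by omega)) t1 t2 t5 h1 h2 v1 v2 v3
    refine h.exists_of_prepend (by omega) h1 h2 (fun k hk hlt => ?_) px hall ?_
    · exact (fx k hk fun e => by rw [e] at hlt; exact lt_irrefl _ hlt).1.1.mpr hlt
    · have := hall 3 (by omega)
      omega
  · have t6 : P (c 2) < P y := by
      have := (gy 2 (by omega)).1
      have := ny 2 (by omega)
      omega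
    exact (hA.prepend_right t1 t4 t5 t6 h1 h2 v1 v2 v3).elim

/-- A twin of a point of an alternation, vertically separated from that point by a point in one of
the corners, enlarges it together with the latter. -/
theorem IsAlternation.enlarge_of_uniform (h : IsAlternation P Q m c) (hm : 2 ≤ m)
    (hP : P.Injective) (hQ : Q.Injective) (hA : AvoidsFive P Q) (hx : x ∉ altSet m c)
    (hy : y ∉ altSet m c) (hxy : x ≠ y) (hu : IsTwin (ordRel P Q) (altSet m c) u x)
    (hyu : IsUniform (ordRel P Q) (altSet m c) y) (hs : ¬ (Q y < Q u ↔ Q y < Q x)) :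
    ∃ P' Q' c', SymmForm P Q P' Q' ∧ IsAlternation P' Q' (m + 1) c' := by
  have h1 := hQ.ne hxy
  have h2 := hQ.ne (show y ≠ u from fun e => hy (e ▸ hu.1))
  have hf : SymmForm P Q (-P) (-Q) := SymmForm.refl.negPos.negVal
  by_cases h3 : Q y < Q u
  · obtain ⟨c', hc'⟩ := h.enlarge_of_uniform_of_lt hm hP hQ hA hx hy hu hyu (by omega) h3
    exact ⟨P, Q, c', SymmForm.refl, hc'⟩
  · rw [← hf.isTwin_iff hP hQ hx, ← altSet_rotate] at hu
    rw [← hf.isUniform_iff hP hQ hy, ← altSet_rotate] at hyu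
    rw [← altSet_rotate] at hx hy
    obtain ⟨hP', hQ'⟩ := hf.injective hP hQ
    obtain ⟨c', hc'⟩ := h.rotate.enlarge_of_uniform_of_lt hm hP' hQ' hA.rotate hx hy hu hyu
      (by simp only [Pi.neg_apply]; omega) (by simp only [Pi.neg_apply]; omega)
    exact ⟨_, _, c', hf, hc'⟩

end Enlarge

section Enlarge

variable {V : Type*} {P Q : V → ℤ} {X : Set V} {u v w x y : V} {m : ℕ} {c : ℕ → V} {i j k : ℕ}

/-- The points `c i` and `c j` would be neighbours in the left half. If no point of the left
half comes after `c j`, then one comes before `c i`, as the left half has at least three points. -/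
theorem IsAlternation.not_gap_odd (h : IsAlternation P Q m c) (hm : 3 ≤ m)
    (hP : P.Injective) (hQ : Q.Injective) (hA : AvoidsFive P Q) (hx : x ∉ altSet m c)
    (hy : y ∉ altSet m c) (hi : i < 2 * m) (hj : j < 2 * m) (hi1 : i % 2 = 1) (hj1 : j % 2 = 1)
    (hu : IsTwin (ordRel P Q) (altSet m c) (c i) x)
    (hv : IsTwin (ordRel P Q) (altSet m c) (c j) y)
    (h1 : P (c i) < P y) (h2 : P y < P x) (h3 : P x < P (c j)) : False := by
  have fx := fun k (hk : k < 2 * m) => h.twin_compare hP hQ hx hi hu hk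
  have fy := fun k (hk : k < 2 * m) => h.twin_compare hP hQ hy hj hv hk
  have hij : i < j := by
    by_contra hij
    rcases Nat.lt_or_eq_of_le (not_lt.mp hij) with h4 | rfl
    · have := h.pos j i h4 hi (by omega)
      omega
    · omega
  obtain rfl : j = i + 2 := by
    by_contra hne
    have h4 := (fx (i + 2) (by omega) (by omega)).1.2.mpr
      (h.pos i (i + 2) (by omega) (by omega) (by omega))
    have h5 := (fy (i + 2) (by omega) (by omega)).1.1.mpr
      (h.pos (i + 2) j (by omega) hj (by omega))
    omega
  have nx : Q (c i) ≠ Q x := hQ.ne fun e => hx (e ▸ mem_altSet hi)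
  have ny : Q y ≠ Q (c (i + 2)) := hQ.ne fun e => hy (e ▸ mem_altSet hj)
  have v1 := h.val (i - 1) i (by omega) hi
  have v2 := h.val i (i + 1) (by omega) (by omega)
  have v3 := h.val (i + 1) (i + 2) (by omega) hj
  have w1 := (fx (i - 1) (by omega) (by omega)).2.1.mpr v1
  have w2 := (fx (i + 1) (by omega) (by omega)).2.2.mpr v2
  have w3 := (fy (i + 1) (by omega) (by omega)).2.1.mpr v3
  have t1 := h.pos (i - 1) (i + 1) (by omega) (by omega) (by omega)
  rcases Nat.lt_or_ge (i + 4) (2 * m) with h4 | h4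
  · exact hA.gap_odd_low h1 h2 h3 (h.pos (i + 2) (i + 4) (by omega) h4 (by omega))
      (h.odd_even (i + 4) (i - 1) h4 (by omega) (by omega) (by omega)) t1 nx ny v1 v2 w2 w3
      ((fy (i + 3) (by omega) (by omega)).2.2.mpr (h.val _ _ (by omega) (by omega)))
      (h.val (i + 3) (i + 4) (by omega) h4)
  · exact hA.gap_odd_high (h.pos (i - 2) i (by omega) hi (by omega)) h1 h2 h3
      (h.odd_even (i + 2) (i - 3) hj (by omega) (by omega) (by omega))
      (h.pos (i - 3) (i - 1) (by omega) (by omega) (by omega)) t1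
      (h.val _ _ (by omega) (by omega)) (h.val _ _ (by omega) (by omega)) w1 w2 w3

/-- Twins of `c i` and `c j` do not interlock horizontally: `c i` and `c j` would be neighbours in
horizontal order, in the same half or on both sides of the middle. -/
theorem IsAlternation.not_gap (h : IsAlternation P Q m c) (hm : 3 ≤ m)
    (hP : P.Injective) (hQ : Q.Injective) (hA : AvoidsFive P Q) (hx : x ∉ altSet m c)
    (hy : y ∉ altSet m c) (hi : i < 2 * m) (hj : j < 2 * m)
    (hu : IsTwin (ordRel P Q) (altSet m c) (c i) x)
    (hv : IsTwin (ordRel P Q) (altSet m c) (c j) y)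
    (h1 : P (c i) < P y) (h2 : P y < P x) (h3 : P x < P (c j)) : False := by
  have fx := fun k (hk : k < 2 * m) => h.twin_compare hP hQ hx hi hu hk
  have fy := fun k (hk : k < 2 * m) => h.twin_compare hP hQ hy hj hv hk
  rcases Nat.mod_two_eq_zero_or_one i with hi1 | hi1 <;>
    rcases Nat.mod_two_eq_zero_or_one j with hj1 | hj1
  · have hf : SymmForm P Q (-P) (-Q) := SymmForm.refl.negPos.negVal
    obtain ⟨hP', hQ'⟩ := hf.injective hP hQ
    rw [← hf.isTwin_iff hP hQ hx, ← altSet_rotate] at hu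
    rw [← hf.isTwin_iff hP hQ hy, ← altSet_rotate] at hv
    rw [← altSet_rotate] at hx hy
    have ei : 2 * m - 1 - (2 * m - 1 - i) = i := by omega
    have ej : 2 * m - 1 - (2 * m - 1 - j) = j := by omega
    refine h.rotate.not_gap_odd hm hP' hQ' hA.rotate hy hx (i := 2 * m - 1 - j)
      (j := 2 * m - 1 - i) (by omega) (by omega) (by omega) (by omega) ?_ ?_ ?_ ?_ ?_
    · rw [ej]
      exact hv
    · rw [ei]
      exact hu
    · simpa only [ej, Pi.neg_apply, neg_lt_neg_iff] using h3
    · simpa only [Pi.neg_apply, neg_lt_neg_iff] using h2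
    · simpa only [ei, Pi.neg_apply, neg_lt_neg_iff] using h1
  · have := h.odd_even j i hj hi hj1 hi1
    omega
  · -- the rightmost odd point and the leftmost even point
    obtain rfl : i = 2 * m - 1 := by
      by_contra hne
      have h4 := (fx (2 * m - 1) (by omega) (by omega)).1.2.mpr
        (h.pos _ _ (by omega) (by omega) (by omega))
      have h5 := (fy (2 * m - 1) (by omega) (by omega)).1.1.mpr
        (h.odd_even _ _ (by omega) hj (by omega) hj1)
      omega
    obtain rfl : j = 0 := by
      by_contra hne
      have h4 := (fx 0 (by omega) (by omega)).1.2.mpr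
        (h.odd_even _ _ hi (by omega) hi1 (by omega))
      have h5 := (fy 0 (by omega) (by omega)).1.1.mpr
        (h.pos _ _ (by omega) hj (by omega))
      omega
    exact hA.gap_middle (h.pos 1 3 (by omega) (by omega) rfl)
      (h.pos 3 (2 * m - 1) (by omega) (by omega) (by omega)) h1 h2 h3
      (h.pos 0 2 (by omega) (by omega) rfl)
      ((fy 1 (by omega) (by omega)).2.2.mpr (h.val 0 1 (by omega) (by omega)))
      (h.val 1 2 (by omega) (by omega)) (h.val 2 3 (by omega) (by omega))
      (h.val 3 (2 * m - 2) (by omega) (by omega))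
      ((fx (2 * m - 2) (by omega) (by omega)).2.1.mpr (h.val _ _ (by omega) (by omega)))
  · exact h.not_gap_odd hm hP hQ hA hx hy hi hj hi1 hj1 hu hv h1 h2 h3

/-- Twins of points of an alternation of length at least six are not horizontally separated. -/
theorem IsAlternation.not_separated_twins (h : IsAlternation P Q m c) (hm : 3 ≤ m)
    (hP : P.Injective) (hQ : Q.Injective) (hA : AvoidsFive P Q) (hx : x ∉ altSet m c)
    (hy : y ∉ altSet m c) (hxy : x ≠ y) (huv : u ≠ v)
    (hu : IsTwin (ordRel P Q) (altSet m c) u x) (hv : IsTwin (ordRel P Q) (altSet m c) v y) :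
    P y < P u ↔ P y < P x := by
  by_contra hs
  have hf : SymmForm P Q Q P := SymmForm.refl.swap
  have h1 := IsTwin.val_order hQ hP hx hy hxy huv ((hf.isTwin_iff hP hQ hx).mpr hu)
    ((hf.isTwin_iff hP hQ hy).mpr hv) hs
  obtain ⟨i, hi, rfl⟩ := hu.1
  obtain ⟨j, hj, rfl⟩ := hv.1
  rcases h1 with ⟨h1, h2, h3⟩ | ⟨h1, h2, h3⟩
  · exact h.not_gap hm hP hQ hA hx hy hi hj hu hv h1 h2 h3
  · exact h.not_gap hm hP hQ hA hy hx hj hi hv hu h1 h2 h3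

/-- The point `u` would be the leftmost one, `c 1`. -/
theorem IsAlternation.not_before_first (h : IsAlternation P Q m c) (hm : 3 ≤ m)
    (hP : P.Injective) (hQ : Q.Injective) (hA : AvoidsFive P Q) (hx : x ∉ altSet m c)
    (hy : y ∉ altSet m c) (hu : IsTwin (ordRel P Q) (altSet m c) u x)
    (hyu : IsUniform (ordRel P Q) (altSet m c) y) (h1 : P x < P y) (h2 : P y < P u) : False := by
  obtain ⟨i, hi, rfl⟩ := hu.1
  have hi : i < 2 * m := hi
  have fx := fun k (hk : k < 2 * m) => h.twin_compare hP hQ hx hi hu hk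
  have gy := fun k (hk : k < 2 * m) => IsAlternation.uniform_compare hyu hk hi
  obtain rfl : i = 1 := by
    by_contra hne
    have t1 : P (c 1) < P (c i) := by
      rcases Nat.mod_two_eq_zero_or_one i with hp | hp
      · exact h.odd_even _ _ (by omega) hi rfl hp
      · exact h.pos _ _ (by omega) hi (by omega)
    have t2 := (fx 1 (by omega) (Ne.symm hne)).1.1.mpr t1
    have t3 := (gy 1 (by omega)).1.mpr h2
    omega
  have nx : Q (c 1) ≠ Q x := hQ.ne fun e => hx (e ▸ mem_altSet hi)
  have ny : Q y ≠ Q (c 1) := hQ.ne fun e => hy (e ▸ mem_altSet hi)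
  have t1 := h.pos 1 3 (by omega) (by omega) rfl
  have t2 := h.pos 3 5 (by omega) (by omega) rfl
  have t3 := h.odd_even 5 0 (by omega) (by omega) rfl rfl
  have t4 := h.pos 0 2 (by omega) (by omega) rfl
  have v1 := h.val 0 1 (by omega) (by omega)
  have v2 := h.val 1 2 (by omega) (by omega)
  have v3 := h.val 2 3 (by omega) (by omega)
  have w1 := (fx 0 (by omega) (by omega)).2.1.mpr v1
  have w2 := (fx 2 (by omega) (by omega)).2.2.mpr v2
  rcases lt_or_gt_of_ne ny with hy0 | hy0
  · exact hA.before_first_bottom h1 h2 t1 t2 t3 t4 nx ((gy 0 (by omega)).2.mpr hy0) v1 w1 w2 v3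
  · have t5 : Q (c 5) < Q y := by
      have := (gy 5 (by omega)).2
      have : Q y ≠ Q (c 5) := hQ.ne fun e => hy (e ▸ mem_altSet (by omega))
      omega
    exact hA.before_first_top h1 h2 t1 t2 t3 t4 (h.pos 2 4 (by omega) (by omega) rfl) nx w1 v2 w2
      v3 (h.val 3 4 (by omega) (by omega)) (h.val 4 5 (by omega) (by omega)) t5

/-- A twin of a point of an alternation of length at least six is not horizontally separated from
that point by a point in one of the corners. -/
theorem IsAlternation.not_separated_uniform (h : IsAlternation P Q m c) (hm : 3 ≤ m)
    (hP : P.Injective) (hQ : Q.Injective) (hA : AvoidsFive P Q) (hx : x ∉ altSet m c)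
    (hy : y ∉ altSet m c) (hxy : x ≠ y) (hu : IsTwin (ordRel P Q) (altSet m c) u x)
    (hyu : IsUniform (ordRel P Q) (altSet m c) y) : P y < P u ↔ P y < P x := by
  by_contra hs
  have h1 := hP.ne hxy
  have h2 := hP.ne (show y ≠ u from fun e => hy (e ▸ hu.1))
  by_cases h3 : P y < P u
  · exact h.not_before_first hm hP hQ hA hx hy hu hyu (by omega) h3
  · have hf : SymmForm P Q (-P) (-Q) := SymmForm.refl.negPos.negVal
    rw [← hf.isTwin_iff hP hQ hx, ← altSet_rotate] at hu
    rw [← hf.isUniform_iff hP hQ hy, ← altSet_rotate] at hyu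
    rw [← altSet_rotate] at hx hy
    obtain ⟨hP', hQ'⟩ := hf.injective hP hQ
    exact h.rotate.not_before_first hm hP' hQ' hA.rotate hx hy hu hyu
      (by simp only [Pi.neg_apply]; omega) (by simp only [Pi.neg_apply]; omega)

/-- The sequence of the points `a, b, c, d`, constant from `d` on. -/
def fourPoints (a b c d : V) (i : ℕ) : V :=
  if i = 0 then a else if i = 1 then b else if i = 2 then c else d

theorem isAlternation_fourPoints {a b c d : V} (p1 : P b < P d) (p2 : P d < P a) (p3 : P a < P c)
    (q1 : Q a < Q b) (q2 : Q b < Q c) (q3 : Q c < Q d) :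
    IsAlternation P Q 2 (fourPoints a b c d) where
  val i j hij hj := by
    have q4 := q1.trans q2
    have q5 := q2.trans q3
    have q6 := q4.trans q3
    have : i < 4 := by omega
    have : j < 4 := hj
    interval_cases i <;> interval_cases j <;>
      first
      | exact q1
      | exact q2
      | exact q3
      | exact q4
      | exact q5
      | exact q6
  pos i j hij hj hp := by
    have : i < 4 := by omega
    have : j < 4 := hj
    interval_cases i <;> interval_cases j <;>
      first
      | exact p1
      | exact p3
      | omega
  odd_even i j hi hj h1 h2 := by
    have p4 := p1.trans p2
    have p5 := p2.trans p3
    have p6 := p4.trans p3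
    have : i < 4 := hi
    have : j < 4 := hj
    interval_cases i <;> interval_cases j <;>
      first
      | exact p2
      | exact p4
      | exact p5
      | exact p6
      | omega

/-- The alternation of length four is invariant under a quarter turn. -/
theorem IsAlternation.exists_quarter_turn (h : IsAlternation P Q 2 c) :
    ∃ c', IsAlternation (-Q) P 2 c' ∧ altSet 2 c' = altSet 2 c := by
  have p1 := h.pos 1 3 (by omega) (by omega) rfl
  have p2 := h.odd_even 3 0 (by omega) (by omega) rfl rfl
  have p3 := h.pos 0 2 (by omega) (by omega) rfl
  have v1 := h.val 0 1 (by omega) (by omega)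
  have v2 := h.val 1 2 (by omega) (by omega)
  have v3 := h.val 2 3 (by omega) (by omega)
  refine ⟨fourPoints (c 1) (c 3) (c 0) (c 2), isAlternation_fourPoints ?_ ?_ ?_ p1 p2 p3, ?_⟩
  · simpa using v3
  · simpa using v2
  · simpa using v1
  · ext w
    constructor
    · rintro ⟨i, hi, rfl⟩
      have : i < 4 := hi
      interval_cases i
      · exact mem_altSet (i := 1) (by omega)
      · exact mem_altSet (i := 3) (by omega)
      · exact mem_altSet (i := 0) (by omega)
      · exact mem_altSet (i := 2) (by omega)
    · rintro ⟨i, hi, rfl⟩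
      have : i < 4 := hi
      interval_cases i
      · exact ⟨2, show 2 < 4 by omega, rfl⟩
      · exact ⟨0, show 0 < 4 by omega, rfl⟩
      · exact ⟨3, show 3 < 4 by omega, rfl⟩
      · exact ⟨1, show 1 < 4 by omega, rfl⟩

theorem IsCritical.enlarge_of_twins [Finite V] (hP : P.Injective) (hQ : Q.Injective)
    (hV : IsCritical (ordRel P Q)) (hm : 2 ≤ m) (h : IsAlternation P Q m c)
    (hx : x ∉ altSet m c) (hy : y ∉ altSet m c) (hxy : x ≠ y) (huv : u ≠ v)
    (hu : IsTwin (ordRel P Q) (altSet m c) u x) (hv : IsTwin (ordRel P Q) (altSet m c) v y)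
    (hs : ordRel P Q y u ≠ ordRel P Q y x) :
    ∃ P' Q' c', SymmForm P Q P' Q' ∧ IsAlternation P' Q' (m + 1) c' := by
  have hA := hV.avoidsFive hP hQ hm h
  rw [Ne, ordRel_eq_iff, not_and_or] at hs
  rcases hs with hs | hs
  · rcases Nat.lt_or_ge 2 m with h3 | h3
    · exact absurd (h.not_separated_twins h3 hP hQ hA hx hy hxy huv hu hv) hs
    · obtain rfl : m = 2 := by omega
      obtain ⟨d, hd, hdc⟩ := h.exists_quarter_turn
      have hf : SymmForm P Q (-Q) P := SymmForm.refl.swap.negPos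
      obtain ⟨hP', hQ'⟩ := hf.injective hP hQ
      have hV' := (hf.isCritical_iff hP hQ).mpr hV
      rw [← hf.isTwin_iff hP hQ hx, ← hdc] at hu
      rw [← hf.isTwin_iff hP hQ hy, ← hdc] at hv
      rw [← hdc] at hx hy
      obtain ⟨c', hc'⟩ := hd.enlarge_of_twins hm hP' hQ' (hV'.avoidsFive hP' hQ' hm hd) hx hy hxy
        huv hu hv hs
      exact ⟨_, _, c', hf, hc'⟩
  · obtain ⟨c', hc'⟩ := h.enlarge_of_twins hm hP hQ hA hx hy hxy huv hu hv hs
    exact ⟨_, _, c', SymmForm.refl, hc'⟩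

theorem IsCritical.enlarge_of_uniform [Finite V] (hP : P.Injective) (hQ : Q.Injective)
    (hV : IsCritical (ordRel P Q)) (hm : 2 ≤ m) (h : IsAlternation P Q m c)
    (hx : x ∉ altSet m c) (hy : y ∉ altSet m c) (hxy : x ≠ y)
    (hu : IsTwin (ordRel P Q) (altSet m c) u x) (hyu : IsUniform (ordRel P Q) (altSet m c) y)
    (hs : ordRel P Q y u ≠ ordRel P Q y x) :
    ∃ P' Q' c', SymmForm P Q P' Q' ∧ IsAlternation P' Q' (m + 1) c' := by
  have hA := hV.avoidsFive hP hQ hm h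
  rw [Ne, ordRel_eq_iff, not_and_or] at hs
  rcases hs with hs | hs
  · rcases Nat.lt_or_ge 2 m with h3 | h3
    · exact absurd (h.not_separated_uniform h3 hP hQ hA hx hy hxy hu hyu) hs
    · obtain rfl : m = 2 := by omega
      obtain ⟨d, hd, hdc⟩ := h.exists_quarter_turn
      have hf : SymmForm P Q (-Q) P := SymmForm.refl.swap.negPos
      obtain ⟨hP', hQ'⟩ := hf.injective hP hQ
      have hV' := (hf.isCritical_iff hP hQ).mpr hV
      rw [← hf.isTwin_iff hP hQ hx, ← hdc] at hu
      rw [← hf.isUniform_iff hP hQ hy, ← hdc] at hyu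
      rw [← hdc] at hx hy
      obtain ⟨P', Q', c', hf', hc'⟩ := hd.enlarge_of_uniform hm hP' hQ'
        (hV'.avoidsFive hP' hQ' hm hd) hx hy hxy hu hyu hs
      exact ⟨_, _, c', hf.trans hf', hc'⟩
  · exact h.enlarge_of_uniform hm hP hQ hA hx hy hxy hu hyu hs

/-- In a critical point set, an alternation that is not everything can be enlarged, possibly after
a symmetry of the square. -/
theorem IsCritical.exists_enlarge [Finite V] (hP : P.Injective) (hQ : Q.Injective)
    (hV : IsCritical (ordRel P Q)) (hm : 2 ≤ m) (h : IsAlternation P Q m c)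
    (hne : altSet m c ≠ Set.univ) :
    ∃ P' Q' c', SymmForm P Q P' Q' ∧ IsAlternation P' Q' (m + 1) c' := by
  have hr := isReversible_ordRel hP hQ
  have hX := h.isPrimeOn hP hQ
  have h3 := h.exists_ne_ne hm
  obtain ⟨l, hl⟩ := hV.even_ncard_compl hr hX h3
  have h0 : ((altSet m c)ᶜ).ncard ≠ 0 := by
    rw [Ne, Set.ncard_eq_zero]
    exact fun e => hne (Set.compl_empty_iff.mp e)
  obtain ⟨x, hx, y, hy, hxy⟩ := (Set.one_lt_ncard).mp (show 1 < ((altSet m c)ᶜ).ncard by omega)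
  obtain ⟨x, y, hx, hy, hxy, hp⟩ := exists_isPrimeOn_insert_insert hr hV.1 hX h3 ⟨x, y, hx, hy, hxy⟩
  -- adding one point does not give a prime set, for parity reasons
  have hkind : ∀ z, z ∉ altSet m c → (∃ u, IsTwin (ordRel P Q) (altSet m c) u z) ∨
      IsUniform (ordRel P Q) (altSet m c) z := by
    intro z hz
    refine twin_or_uniform_of_not_isPrimeOn_insert hX fun hpz => ?_
    obtain ⟨k, hk⟩ := hV.even_ncard_compl hr hpz fun u v => by
      obtain ⟨w, hw, hwuv⟩ := h3 u v
      exact ⟨w, Or.inr hw, hwuv⟩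
    have e : (insert z (altSet m c))ᶜ = (altSet m c)ᶜ \ {z} := by
      ext w
      simp only [Set.mem_compl_iff, Set.mem_insert_iff, Set.mem_sdiff, Set.mem_singleton_iff]
      tauto
    have e1 := Set.ncard_sdiff_singleton_add_one (show z ∈ (altSet m c)ᶜ from hz)
    rw [← e] at e1
    omega
  have hp' := hp
  rw [Set.insert_comm] at hp'
  rcases hkind x hx with ⟨u, hu⟩ | hux <;> rcases hkind y hy with ⟨v, hv⟩ | huy
  · by_cases huv : u = v
    · subst huv
      exact (hp.not_isTwin_isTwin h3 hx hy hu hv).elim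
    · exact hV.enlarge_of_twins hP hQ hm h hx hy hxy huv hu hv (hp.ne_of_isTwin h3 hx hu)
  · exact hV.enlarge_of_uniform hP hQ hm h hx hy hxy hu huy (hp.ne_of_isTwin h3 hx hu)
  · exact hV.enlarge_of_uniform hP hQ hm h hy hx hxy.symm hv hux (hp'.ne_of_isTwin h3 hy hv)
  · exact (hp.not_isUniform_isUniform h3 hx hux huy).elim

end Enlarge

/-! ### An alternation of length four -/

section Start

variable {V : Type*} {P Q : V → ℤ} {f p q : V}

/-- In a prime set of at least three points the leftmost one is not the lowest. -/
theorem IsPrimeOn.exists_val_lt (hP : P.Injective) (hQ : Q.Injective)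
    (hV : IsPrimeOn (ordRel P Q) Set.univ) (h3 : ∀ u v : V, ∃ w, w ≠ u ∧ w ≠ v)
    (hf : ∀ z, P f ≤ P z) : ∃ z, Q z < Q f := by
  by_contra! hcon
  have hmod : IsModule (ordRel P Q) Set.univ {f}ᶜ := by
    rw [isModule_ordRel_iff hP hQ]
    refine ⟨Set.subset_univ _, fun z _ a ha b hb => ⟨fun h1 _ => ?_, fun h1 _ => ?_⟩⟩
    · rintro rfl
      exact absurd h1 (not_lt.mpr (hf a))
    · rintro rfl
      exact absurd h1 (not_lt.mpr (hcon a))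
  obtain ⟨a, haf, -⟩ := h3 f f
  obtain ⟨b, hbf, hba⟩ := h3 f a
  rcases hV _ hmod with h | h
  · exact hba (h hbf haf)
  · have : f ∈ ({f}ᶜ : Set V) := by rw [h]; trivial
    exact this rfl

/-- Suppose that the second point from the left is higher than the leftmost point `f`. The points
above `f` and those below `f` alternate at least twice from left to right: with `q` the first
point below `f` and `t` the first point above `f` after `q`, an alternation of length four is found
because the points to the left of `t` do not form a module. -/
theorem IsPrimeOn.exists_alternation_two_of_lt [Finite V] (hP : P.Injective) (hQ : Q.Injective)
    (hV : IsPrimeOn (ordRel P Q) Set.univ) (hf : ∀ z, P f ≤ P z) (hp : Q f < Q p)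
    (hpq : ∀ z, Q z < Q f → P p < P z) (hq : Q q < Q f) :
    ∃ P' Q' c, SymmForm P Q P' Q' ∧ IsAlternation P' Q' 2 c := by
  classical
  obtain ⟨q, hq, hqmin⟩ := Set.exists_min_image {z | Q z < Q f} P (Set.toFinite _) ⟨q, hq⟩
  have hq : Q q < Q f := hq
  have hfp : P f < P p := (hf p).lt_of_ne (hP.ne fun e => by rw [e] at hp; exact lt_irrefl _ hp)
  have hfp' : f ≠ p := fun e => by rw [e] at hp; exact lt_irrefl _ hp
  have hpq' := hpq q hq
  have ht : ∃ t, Q f < Q t ∧ P q < P t := by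
    by_contra! hcon
    have hmod : IsModule (ordRel P Q) Set.univ {z | P z < P q} := by
      rw [isModule_ordRel_iff hP hQ]
      refine ⟨Set.subset_univ _, fun z _ a ha b hb =>
        ⟨fun _ h1 => lt_trans h1 hb, fun h1 _ => ?_⟩⟩
      have ha : P a < P q := ha
      have haf : Q f ≤ Q a := not_lt.mp fun h2 => absurd (hqmin a h2) (not_le.mpr ha)
      refine (hcon z (by omega)).lt_of_ne (hP.ne ?_)
      rintro rfl
      omega
    rcases hV _ hmod with h | h
    · exact hfp' (h (show P f < P q by omega) hpq')
    · have : q ∈ {z | P z < P q} := by rw [h]; trivial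
      exact lt_irrefl (P q) this
  obtain ⟨t, ⟨ht, hqt⟩, htmin⟩ := Set.exists_min_image {t | Q f < Q t ∧ P q < P t} P
    (Set.toFinite _) ht
  by_contra hno
  have hmod : IsModule (ordRel P Q) Set.univ {z | P z < P t} := by
    rw [isModule_ordRel_iff hP hQ]
    refine ⟨Set.subset_univ _, fun z _ a ha b hb =>
      ⟨fun _ h1 => lt_trans h1 hb, fun h1 h2 => ?_⟩⟩
    have ha : P a < P t := ha
    have hb : P b < P t := hb
    by_contra hz
    have hz : P t ≤ P z := not_lt.mp hz
    have hzf : z ≠ f := by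
      rintro rfl
      omega
    rcases lt_or_gt_of_ne (hQ.ne hzf) with h3 | h3
    · -- the four points `f`, `a`, `t`, `z` form the pattern 3142
      have hzt : P t < P z := hz.lt_of_ne (hP.ne fun e => by rw [e] at ht; omega)
      have hqa := hqmin a (show Q a < Q f by omega)
      have hfq : P f < P q := by omega
      exact hno ⟨-P, Q, fourPoints a z f t, SymmForm.refl.negPos, isAlternation_fourPoints
        (neg_lt_neg hzt) (neg_lt_neg ha) (neg_lt_neg (by omega)) h1 h3 ht⟩
    · -- the four points `f`, `b`, `q`, `z` form the pattern 2413
      have hbq : P b < P q := by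
        by_contra hbq
        have hne : b ≠ q := by
          rintro rfl
          omega
        have := hP.ne hne
        exact absurd (htmin b ⟨by omega, by omega⟩) (not_le.mpr hb)
      have hfb : P f < P b := (hf b).lt_of_ne (hP.ne fun e => by rw [e] at h3; omega)
      exact hno ⟨P, Q, fourPoints q f z b, SymmForm.refl, isAlternation_fourPoints
        hfb hbq (by omega) hq h3 h2⟩
  rcases hV _ hmod with h | h
  · exact hfp' (h (show P f < P t by omega) (show P p < P t by omega))
  · have : t ∈ {z | P z < P t} := by rw [h]; trivial
    exact lt_irrefl (P t) this

/-- A prime set of at least three points contains one of the patterns 2413 and 3142. -/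
theorem IsPrimeOn.exists_alternation_two [Finite V] [Nonempty V] (hP : P.Injective)
    (hQ : Q.Injective) (hV : IsPrimeOn (ordRel P Q) Set.univ)
    (h3 : ∀ u v : V, ∃ w, w ≠ u ∧ w ≠ v) :
    ∃ P' Q' c, SymmForm P Q P' Q' ∧ IsAlternation P' Q' 2 c := by
  obtain ⟨f, hf⟩ := Finite.exists_min P
  have hn : SymmForm P Q P (-Q) := SymmForm.refl.negVal
  obtain ⟨-, hQ'⟩ := hn.injective hP hQ
  have hV' := (hn.isPrimeOn_iff hP hQ).mpr hV
  obtain ⟨q, hq⟩ := hV.exists_val_lt hP hQ h3 hf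
  obtain ⟨p, hp⟩ := hV'.exists_val_lt hP hQ' h3 hf
  obtain ⟨q, hq, hqmin⟩ := Set.exists_min_image {z | Q z < Q f} P (Set.toFinite _) ⟨q, hq⟩
  obtain ⟨p, hp, hpmin⟩ := Set.exists_min_image {z | (-Q) z < (-Q) f} P (Set.toFinite _) ⟨p, hp⟩
  have hp' : Q f < Q p := by simpa using hp
  have hq : Q q < Q f := hq
  rcases lt_or_ge (P p) (P q) with h | h
  · exact hV.exists_alternation_two_of_lt hP hQ hf hp' (fun z hz => h.trans_le (hqmin z hz)) hq
  · have hne : P q < P p := h.lt_of_ne (hP.ne fun e => by rw [e] at hq; omega)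
    obtain ⟨P', Q', c, hs, hc⟩ := hV'.exists_alternation_two_of_lt hP hQ' hf
      (p := q) (q := p) (by simpa using hq) (fun z hz => hne.trans_le (hpmin z hz)) hp
    exact ⟨P', Q', c, hn.trans hs, hc⟩

end Start

/-- A critical point set with at least three points is, up to a symmetry of the square, a parallel
alternation. -/
theorem IsCritical.exists_alternation {V : Type*} {P Q : V → ℤ} [Finite V] [Nonempty V]
    (hP : P.Injective) (hQ : Q.Injective) (hV : IsCritical (ordRel P Q))
    (h3 : ∀ u v : V, ∃ w, w ≠ u ∧ w ≠ v) :
    ∃ P' Q' m c, 2 ≤ m ∧ SymmForm P Q P' Q' ∧ IsAlternation P' Q' m c ∧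
      altSet m c = Set.univ := by
  -- enlarge an alternation until it is everything; the number of missing points decreases
  have key : ∀ (k m : ℕ) P' Q' c, Nat.card V ≤ 2 * m + k → 2 ≤ m → SymmForm P Q P' Q' →
      IsAlternation P' Q' m c → ∃ P' Q' m c, 2 ≤ m ∧ SymmForm P Q P' Q' ∧
        IsAlternation P' Q' m c ∧ altSet m c = Set.univ := by
    intro k
    induction k with
    | zero =>
      intro m P' Q' c hk hm hf hc
      refine ⟨P', Q', m, c, hm, hf, hc, ?_⟩
      refine Set.eq_of_subset_of_ncard_le (Set.subset_univ _) ?_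
      rw [hc.ncard_altSet, Set.ncard_univ]
      omega
    | succ k ih =>
      intro m P' Q' c hk hm hf hc
      by_cases hne : altSet m c = Set.univ
      · exact ⟨P', Q', m, c, hm, hf, hc, hne⟩
      · obtain ⟨hP', hQ'⟩ := hf.injective hP hQ
        obtain ⟨P'', Q'', c', hf', hc'⟩ :=
          ((hf.isCritical_iff hP hQ).mpr hV).exists_enlarge hP' hQ' hm hc hne
        exact ih (m + 1) P'' Q'' c' (by omega) (by omega) (hf.trans hf') hc'
  obtain ⟨P', Q', c, hf, hc⟩ := hV.1.exists_alternation_two hP hQ h3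
  exact key (Nat.card V) 2 P' Q' c (by omega) le_rfl hf hc

/-! ### Permutations and their plots -/

section Plot

variable {V : Type*} {P Q P' Q' : V → ℤ} {k n m : ℕ} {σ π ρ : Equiv.Perm (Fin k)} {g : Fin k → V}
  {c : ℕ → V}

/-- The points `g 0, g 1, …`, with horizontal coordinates `P` and vertical coordinates `Q`, form the
plot of the permutation `σ` up to monotone changes of the coordinates. -/
def IsPlot (σ : Equiv.Perm (Fin k)) (g : Fin k → V) (P Q : V → ℤ) : Prop :=
  ∀ i j, (P (g i) < P (g j) ↔ i < j) ∧ (Q (g i) < Q (g j) ↔ σ i < σ j)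

theorem IsPlot.injective (h : IsPlot σ g P Q) : g.Injective := by
  intro i j e
  by_contra hne
  rcases lt_or_gt_of_ne hne with h1 | h1
  · have := (h i j).1.mpr h1
    rw [e] at this
    exact lt_irrefl _ this
  · have := (h j i).1.mpr h1
    rw [e] at this
    exact lt_irrefl _ this

theorem IsPlot.injective_coords (h : IsPlot σ g P Q) (hg : Set.range g = Set.univ) :
    P.Injective ∧ Q.Injective := by
  have hs : ∀ a, ∃ i, g i = a := fun a => by
    have : a ∈ Set.range g := by rw [hg]; trivial
    exact this
  constructor
  · intro a b e
    obtain ⟨i, rfl⟩ := hs a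
    obtain ⟨j, rfl⟩ := hs b
    have h1 := (h i j).1
    have h2 := (h j i).1
    rw [e] at h1 h2
    congr 1
    simp only [lt_irrefl, false_iff, not_lt] at h1 h2
    exact le_antisymm h2 h1
  · intro a b e
    obtain ⟨i, rfl⟩ := hs a
    obtain ⟨j, rfl⟩ := hs b
    have h1 := (h i j).2
    have h2 := (h j i).2
    rw [e] at h1 h2
    congr 1
    simp only [lt_irrefl, false_iff, not_lt] at h1 h2
    exact σ.injective (le_antisymm h2 h1)

/-- Intervals correspond to modules. -/
theorem IsPlot.isInterval_iff (h : IsPlot σ g P Q) (hP : P.Injective) (hQ : Q.Injective)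
    {I : Set (Fin k)} :
    IsInterval σ I ↔ IsModule (ordRel P Q) (Set.range g) (g '' I) := by
  rw [isModule_ordRel_iff hP hQ, IsInterval]
  constructor
  · rintro ⟨h1, h2⟩
    refine ⟨Set.image_subset_range g I, ?_⟩
    rintro _ ⟨l, rfl⟩ _ ⟨i, hi, rfl⟩ _ ⟨j, hj, rfl⟩
    refine ⟨fun h3 h4 => ?_, fun h3 h4 => ?_⟩
    · exact ⟨l, h1.out hi hj ⟨((h i l).1.mp h3).le, ((h l j).1.mp h4).le⟩, rfl⟩
    · obtain ⟨l', hl', e⟩ := h2.out ⟨i, hi, rfl⟩ ⟨j, hj, rfl⟩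
        ⟨((h i l).2.mp h3).le, ((h l j).2.mp h4).le⟩
      rw [σ.injective e] at hl'
      exact ⟨l, hl', rfl⟩
  · rintro ⟨-, h1⟩
    have mem : ∀ {l}, g l ∈ g '' I → l ∈ I := fun hl => h.injective.mem_set_image.mp hl
    refine ⟨⟨fun i hi j hj l hl => ?_⟩, ⟨?_⟩⟩
    · rcases hl.1.eq_or_lt with rfl | h3
      · exact hi
      rcases hl.2.eq_or_lt with rfl | h4
      · exact hj
      exact mem ((h1 _ ⟨l, rfl⟩ _ ⟨i, hi, rfl⟩ _ ⟨j, hj, rfl⟩).1 ((h i l).1.mpr h3)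
        ((h l j).1.mpr h4))
    · rintro _ ⟨i, hi, rfl⟩ _ ⟨j, hj, rfl⟩ v hv
      obtain ⟨l, rfl⟩ := σ.surjective v
      rcases hv.1.eq_or_lt with h3 | h3
      · exact ⟨i, hi, h3⟩
      rcases hv.2.eq_or_lt with h4 | h4
      · exact ⟨j, hj, h4.symm⟩
      exact ⟨l, mem ((h1 _ ⟨l, rfl⟩ _ ⟨i, hi, rfl⟩ _ ⟨j, hj, rfl⟩).2 ((h i l).2.mpr h3)
        ((h l j).2.mpr h4)), rfl⟩

theorem IsPlot.isSimple_iff (h : IsPlot σ g P Q) (hP : P.Injective) (hQ : Q.Injective) :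
    IsSimple σ ↔ IsPrimeOn (ordRel P Q) (Set.range g) := by
  constructor
  · intro hs M hM
    obtain ⟨I, rfl⟩ := Set.subset_range_iff_exists_image_eq.mp hM.1
    rcases hs I ((h.isInterval_iff hP hQ).mpr hM) with h1 | rfl
    · exact Or.inl (h1.image g)
    · exact Or.inr Set.image_univ
  · intro hp I hI
    rcases hp _ ((h.isInterval_iff hP hQ).mp hI) with h1 | h1
    · exact Or.inl fun i hi j hj => h.injective (h1 ⟨i, hi, rfl⟩ ⟨j, hj, rfl⟩)
    · right
      rw [← Set.image_univ] at h1
      exact h.injective.image_injective h1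

/-- Every position can be deleted. -/
theorem exists_isOnePointDeletion (π : Equiv.Perm (Fin (k + 1))) (p : Fin (k + 1)) :
    ∃ σ : Equiv.Perm (Fin k), ∀ i j, σ i < σ j ↔ π (p.succAbove i) < π (p.succAbove j) := by
  set v : Fin k → Fin (k + 1) := fun i => π (p.succAbove i) with hv
  have hinj : v.Injective := π.injective.comp Fin.succAbove_right_injective
  have hmono : StrictMono (v ∘ Tuple.sort v) :=
    (Tuple.monotone_sort v).strictMono_of_injective (hinj.comp (Tuple.sort v).injective)
  refine ⟨(Tuple.sort v).symm, fun i j => ?_⟩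
  rw [← hmono.lt_iff_lt]
  simp [hv]

theorem IsPlot.isExceptional_iff (h : IsPlot π g P Q) (hg : Set.range g = Set.univ) :
    IsExceptional π ↔ IsCritical (ordRel P Q) := by
  obtain ⟨hP, hQ⟩ := h.injective_coords hg
  have hbij : g.Bijective := ⟨h.injective, Set.range_eq_univ.mp hg⟩
  have himg : ∀ p, g '' {p}ᶜ = {g p}ᶜ := fun p => by
    rw [Set.image_compl_eq hbij, Set.image_singleton]
  refine and_congr ?_ ⟨fun hdel p hp => ?_, fun hcrit l σ hσ hs => ?_⟩
  · rw [h.isSimple_iff hP hQ, hg]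
  · obtain ⟨i, rfl⟩ := hbij.2 p
    obtain ⟨l, rfl⟩ : ∃ l, k = l + 1 := ⟨k - 1, by have := i.isLt; omega⟩
    obtain ⟨σ, hσ⟩ := exists_isOnePointDeletion π i
    refine hdel l σ ⟨i, Fin.succAboveOrderEmb i, by simp, by simpa using hσ⟩ ?_
    have hplot : IsPlot σ (g ∘ i.succAbove) P Q := fun a b => by
      rw [hσ]
      simpa using h (i.succAbove a) (i.succAbove b)
    rw [hplot.isSimple_iff hP hQ, Set.range_comp, Fin.range_succAbove, himg]
    exact hp
  · obtain ⟨p, f, hf, hord⟩ := hσ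
    have hplot : IsPlot σ (g ∘ f) P Q := fun a b => by
      rw [hord]
      simpa using h (f a) (f b)
    rw [hplot.isSimple_iff hP hQ, Set.range_comp, hf, himg] at hs
    exact hcrit _ hs

theorem IsPlot.reverse (h : IsPlot π g P Q) :
    IsPlot (Fin.revPerm.trans π) (g ∘ Fin.rev) (-P) Q := fun i j => by
  have h1 := (h j.rev i.rev).1
  have h2 := (h i.rev j.rev).2
  simpa [Fin.rev_lt_rev] using And.intro h1 h2

theorem IsPlot.complement (h : IsPlot π g P Q) : IsPlot (π.trans Fin.revPerm) g P (-Q) :=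
  fun i j => by
  have h1 := (h i j).1
  have h2 := (h j i).2
  simpa [Fin.rev_lt_rev] using And.intro h1 h2

theorem IsPlot.inverse (h : IsPlot π g P Q) : IsPlot π.symm (g ∘ π.symm) Q P := fun i j => by
  have := h (π.symm i) (π.symm j)
  simpa [and_comm] using this

/-- A symmetry of the square applied to a plot gives the plot of a symmetry of the permutation. -/
theorem IsPlot.exists_of_symmForm (h : IsPlot π g P Q) (hg : Set.range g = Set.univ)
    (hs : SymmForm P Q P' Q') :
    ∃ τ g', IsSymmetry π τ ∧ IsPlot τ g' P' Q' ∧ Set.range g' = Set.univ := by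
  induction hs with
  | refl => exact ⟨π, g, IsSymmetry.refl, h, hg⟩
  | negPos _ ih =>
    obtain ⟨τ, g', h1, h2, h3⟩ := ih
    exact ⟨_, _, h1.reverse, h2.reverse, by rw [Fin.rev_surjective.range_comp, h3]⟩
  | negVal _ ih =>
    obtain ⟨τ, g', h1, h2, h3⟩ := ih
    exact ⟨_, _, h1.complement, h2.complement, h3⟩
  | swap _ ih =>
    obtain ⟨τ, g', h1, h2, h3⟩ := ih
    exact ⟨_, _, h1.inverse, h2.inverse, by rw [τ.symm.surjective.range_comp, h3]⟩

/-- A symmetry of a permutation has a plot obtained by a symmetry of the square. -/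
theorem IsPlot.exists_of_isSymmetry (h : IsPlot ρ g P Q) (hg : Set.range g = Set.univ)
    (hs : IsSymmetry ρ π) :
    ∃ P' Q' g', SymmForm P Q P' Q' ∧ IsPlot π g' P' Q' ∧ Set.range g' = Set.univ := by
  induction hs with
  | refl => exact ⟨P, Q, g, SymmForm.refl, h, hg⟩
  | reverse _ ih =>
    obtain ⟨P', Q', g', h1, h2, h3⟩ := ih
    exact ⟨_, _, _, h1.negPos, h2.reverse, by rw [Fin.rev_surjective.range_comp, h3]⟩
  | complement _ ih =>
    obtain ⟨P', Q', g', h1, h2, h3⟩ := ih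
    exact ⟨_, _, _, h1.negVal, h2.complement, h3⟩
  | @inverse τ _ ih =>
    obtain ⟨P', Q', g', h1, h2, h3⟩ := ih
    exact ⟨_, _, _, h1.swap, h2.inverse, by rw [τ.symm.surjective.range_comp, h3]⟩

theorem IsSymmetry.trans (h : IsSymmetry ρ σ) (h' : IsSymmetry σ π) : IsSymmetry ρ π := by
  induction h' with
  | refl => exact h
  | reverse _ ih => exact ih.reverse
  | complement _ ih => exact ih.complement
  | inverse _ ih => exact ih.inverse

theorem IsSymmetry.symm (h : IsSymmetry ρ π) : IsSymmetry π ρ := by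
  induction h with
  | refl => exact IsSymmetry.refl
  | @reverse τ _ ih =>
    refine IsSymmetry.trans ?_ ih
    have : τ = Fin.revPerm.trans (Fin.revPerm.trans τ) := by
      ext i
      simp
    nth_rewrite 2 [this]
    exact IsSymmetry.refl.reverse
  | @complement τ _ ih =>
    refine IsSymmetry.trans ?_ ih
    have : τ = (τ.trans Fin.revPerm).trans Fin.revPerm := by
      ext i
      simp
    nth_rewrite 2 [this]
    exact IsSymmetry.refl.complement
  | @inverse τ _ ih =>
    refine IsSymmetry.trans ?_ ih
    exact (IsSymmetry.refl (π := τ.symm)).inverse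

end Plot

/-! ### The parallel alternation -/

section ParallelAlternation

variable {V W : Type*} {P Q : V → ℤ} {P' Q' : W → ℤ} {m : ℕ} {c : ℕ → V} {c' : ℕ → W}

theorem IsAlternation.pos_iff (h : IsAlternation P Q m c) {i j : ℕ} (hi : i < 2 * m)
    (hj : j < 2 * m) :
    P (c i) < P (c j) ↔ i % 2 = j % 2 ∧ i < j ∨ i % 2 = 1 ∧ j % 2 = 0 := by
  constructor
  · intro h1
    by_contra h2
    have h3 : i = j ∨ (j % 2 = i % 2 ∧ j < i) ∨ j % 2 = 1 ∧ i % 2 = 0 := by omega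
    rcases h3 with rfl | ⟨h3, h4⟩ | ⟨h3, h4⟩
    · exact lt_irrefl _ h1
    · exact lt_asymm h1 (h.pos j i h4 hi h3)
    · exact lt_asymm h1 (h.odd_even j i hj hi h3 h4)
  · rintro (⟨h1, h2⟩ | ⟨h1, h2⟩)
    · exact h.pos i j h2 hj h1
    · exact h.odd_even i j hi hj h1 h2

theorem perm_eq_of_lt_iff_lt {k : ℕ} {σ τ : Equiv.Perm (Fin k)}
    (h : ∀ i j, σ i < σ j ↔ τ i < τ j) : σ = τ := by
  let e : Fin k ≃o Fin k :=
    { toEquiv := σ.symm.trans τ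
      map_rel_iff' := by
        intro a b
        have := h (σ.symm b) (σ.symm a)
        simp only [Equiv.apply_symm_apply] at this
        rw [← not_lt, ← not_lt, this]
        rfl }
  have he : e = OrderIso.refl _ := Subsingleton.elim _ _
  ext i
  have : e (σ i) = σ i := by rw [he]; rfl
  simp only [e, RelIso.coe_fn_mk, Equiv.trans_apply, Equiv.symm_apply_apply] at this
  rw [this]

/-- In the plot of a permutation of length `2 * m` that is an alternation, the point `c j` has
value `j`. -/
theorem IsAlternation.eq_symm_apply (h : IsAlternation P Q m c) (hc : altSet m c = Set.univ)
    {σ : Equiv.Perm (Fin (2 * m))} {g : Fin (2 * m) → V} (hσ : IsPlot σ g P Q)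
    (hg : Set.range g = Set.univ) (j : Fin (2 * m)) : c j = g (σ.symm j) := by
  have hsurj : ∀ l, ∃ i : Fin (2 * m), c i = g l := fun l => by
    have : g l ∈ altSet m c := by rw [hc]; trivial
    obtain ⟨i, hi, e⟩ := this
    exact ⟨⟨i, hi⟩, e⟩
  have hex : ∀ i : Fin (2 * m), ∃ l, g l = c i := fun i => by
    have : c i ∈ Set.range g := by rw [hg]; trivial
    exact this
  choose d hd using hex
  have hdinj : d.Injective := fun i i' e => by
    have : c i = c i' := by rw [← hd, ← hd, e]
    by_contra hne
    exact h.ne i.isLt i'.isLt (fun e => hne (Fin.ext e)) this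
  let D : Equiv.Perm (Fin (2 * m)) := Equiv.ofBijective d (Finite.injective_iff_bijective.mp hdinj)
  have hD : D.trans σ = Equiv.refl _ := perm_eq_of_lt_iff_lt fun i i' => by
    have := (hσ (d i) (d i')).2
    rw [hd, hd, h.val_iff i.isLt i'.isLt] at this
    exact this.symm
  have : σ (d j) = j := Equiv.congr_fun hD j
  rw [← hd, ← this, Equiv.symm_apply_apply, this]

theorem IsPlot.eq_of_isAlternation {σ τ : Equiv.Perm (Fin (2 * m))} {g : Fin (2 * m) → V}
    {g' : Fin (2 * m) → W} (hσ : IsPlot σ g P Q) (hτ : IsPlot τ g' P' Q')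
    (hg : Set.range g = Set.univ) (hg' : Set.range g' = Set.univ)
    (h : IsAlternation P Q m c) (h' : IsAlternation P' Q' m c')
    (hc : altSet m c = Set.univ) (hc' : altSet m c' = Set.univ) : σ = τ := by
  have : σ.symm = τ.symm := perm_eq_of_lt_iff_lt fun i j => by
    rw [← (hσ _ _).1, ← (hτ _ _).1, ← h.eq_symm_apply hc hσ hg, ← h.eq_symm_apply hc hσ hg,
      ← h'.eq_symm_apply hc' hτ hg', ← h'.eq_symm_apply hc' hτ hg', h.pos_iff i.isLt j.isLt,
      h'.pos_iff i.isLt j.isLt]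
  exact Equiv.symm_bijective.injective this

theorem isPlot_self {k : ℕ} (π : Equiv.Perm (Fin k)) :
    IsPlot π id (fun i => (i : ℤ)) (fun i => (π i : ℤ)) := fun i j => by
  simp

theorem exists_isAlternation_parallelAlternation (hm : 0 < m) :
    ∃ c : ℕ → Fin (2 * m), IsAlternation (fun i : Fin (2 * m) => ((i : ℕ) : ℤ))
      (fun i : Fin (2 * m) => ((parallelAlternation m i : ℕ) : ℤ)) m c ∧ altSet m c = Set.univ := by
  let c : ℕ → Fin (2 * m) := fun j =>
    if h : j < 2 * m then (parallelAlternation m).symm ⟨j, h⟩ else ⟨0, by omega⟩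
  have hcval : ∀ j, j < 2 * m → (parallelAlternation m (c j) : ℕ) = j := fun j hj => by
    simp [c, hj]
  have hcpos : ∀ j, j < 2 * m → (c j : ℕ) = if j % 2 = 1 then j / 2 else m + j / 2 :=
    fun j hj => by
      simp only [c, hj, dite_true]
      simp only [parallelAlternation, Equiv.coe_fn_symm_mk]
      split_ifs <;> rfl
  refine ⟨c, ⟨fun i j hij hj => ?_, fun i j hij hj hp => ?_, fun i j hi hj h1 h2 => ?_⟩, ?_⟩
  · simp only [hcval i (by omega), hcval j hj]
    omega
  · simp only [hcpos i (by omega), hcpos j hj]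
    split_ifs <;> omega
  · simp only [hcpos i hi, hcpos j hj]
    split_ifs <;> omega
  · ext a
    simp only [Set.mem_univ, iff_true]
    refine ⟨parallelAlternation m a, (parallelAlternation m a).isLt, ?_⟩
    simp [c]

/-- An alternation is critical: without `c i` the points `c (i - 1)` and `c (i + 1)` form a module,
and without the lowest or highest point the adjacent one lies in a corner. -/
theorem IsAlternation.isCritical (h : IsAlternation P Q m c) (hm : 2 ≤ m) (hP : P.Injective)
    (hQ : Q.Injective) (hc : altSet m c = Set.univ) : IsCritical (ordRel P Q) := by
  refine ⟨hc ▸ h.isPrimeOn hP hQ, fun p hp => ?_⟩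
  have hsurj : ∀ a, ∃ i < 2 * m, c i = a := fun a => by
    have : a ∈ altSet m c := by rw [hc]; trivial
    exact this
  have corner : ∀ i i' j j', i < 2 * m → i' < 2 * m → j < 2 * m → j' < 2 * m → j ≠ j' → j ≠ i →
      j ≠ i' → j' ≠ i → j' ≠ i' → i ≠ i' →
      ((∀ k < 2 * m, k ≠ i → k ≠ i' → P (c i') < P (c k) ∧ Q (c i') < Q (c k)) ∨
        ∀ k < 2 * m, k ≠ i → k ≠ i' → P (c k) < P (c i') ∧ Q (c k) < Q (c i')) →
      ¬ IsPrimeOn (ordRel P Q) {c i}ᶜ := by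
    intro i i' j j' hi hi' hj hj' hjj hji hji' hj'i hj'i' hii hcor hprime
    have hmod : IsModule (ordRel P Q) {c i}ᶜ {c i, c i'}ᶜ := by
      rw [isModule_ordRel_iff hP hQ]
      refine ⟨fun a ha e => ha (Or.inl e), fun z hz a ha b hb => ?_⟩
      have key : ∀ a, a ∈ ({c i, c i'}ᶜ : Set V) → ∃ k < 2 * m, k ≠ i ∧ k ≠ i' ∧ c k = a := by
        intro a ha
        obtain ⟨k, hk, rfl⟩ := hsurj a
        refine ⟨k, hk, ?_, ?_, rfl⟩
        · rintro rfl
          exact ha (Or.inl rfl)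
        · rintro rfl
          exact ha (Or.inr rfl)
      obtain ⟨ka, hka, hkai, hkai', rfl⟩ := key a ha
      obtain ⟨kb, hkb, hkbi, hkbi', rfl⟩ := key b hb
      by_cases hzi : z = c i'
      · subst hzi
        rcases hcor with hcor | hcor
        · have := hcor ka hka hkai hkai'
          exact ⟨fun h1 => by omega, fun h1 => by omega⟩
        · have := hcor kb hkb hkbi hkbi'
          exact ⟨fun _ h1 => by omega, fun _ h1 => by omega⟩
      · have : z ∈ ({c i, c i'}ᶜ : Set V) := by
          rintro (e | e)
          · exact hz e
          · exact hzi e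
        exact ⟨fun _ _ => this, fun _ _ => this⟩
    have mem : ∀ k < 2 * m, k ≠ i → k ≠ i' → c k ∈ ({c i, c i'}ᶜ : Set V) := by
      rintro k hk h1 h2 (e | e)
      · exact h.ne hk hi h1 e
      · exact h.ne hk hi' h2 e
    rcases hprime _ hmod with h1 | h1
    · exact h.ne hj hj' hjj (h1 (mem j hj hji hji') (mem j' hj' hj'i hj'i'))
    · have : c i' ∈ ({c i, c i'}ᶜ : Set V) := by
        rw [h1]
        exact h.ne hi' hi hii.symm
      exact this (Or.inr rfl)
  obtain ⟨i, hi, rfl⟩ := hsurj p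
  rcases Nat.eq_zero_or_pos i with rfl | hi0
  · refine corner 0 1 2 3 hi (by omega) (by omega) (by omega) (by omega) (by omega) (by omega)
      (by omega) (by omega) (by omega) (Or.inl fun k hk h0 h1 => ?_) hp
    exact ⟨(h.pos_iff (by omega) hk).mpr (by omega), h.val _ _ (by omega) hk⟩
  rcases Nat.lt_or_eq_of_le (show i ≤ 2 * m - 1 by omega) with hi1 | hi1
  · have hmod : IsModule (ordRel P Q) {c i}ᶜ {c (i - 1), c (i + 1)} := by
      rw [isModule_ordRel_iff hP hQ]
      refine ⟨?_, fun z hz a ha b hb => ?_⟩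
      · rintro a (rfl | rfl)
        · exact h.ne (by omega) hi (by omega)
        · exact h.ne (by omega) hi (by omega)
      · obtain ⟨k, hk, rfl⟩ := hsurj z
        have hki : k ≠ i := by
          rintro rfl
          exact hz rfl
        have hbound : ∀ a ∈ ({c (i - 1), c (i + 1)} : Set V), ∃ l < 2 * m,
            (l = i - 1 ∨ l = i + 1) ∧ c l = a := by
          rintro a (rfl | rfl)
          · exact ⟨i - 1, by omega, Or.inl rfl, rfl⟩
          · exact ⟨i + 1, by omega, Or.inr rfl, rfl⟩
        obtain ⟨la, hla, hla', rfl⟩ := hbound a ha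
        obtain ⟨lb, hlb, hlb', rfl⟩ := hbound b hb
        rw [h.pos_iff hla hk, h.pos_iff hk hlb, h.val_iff hla hk, h.val_iff hk hlb]
        exact ⟨fun h1 h2 => by omega, fun h1 h2 => by omega⟩
    rcases hp _ hmod with h1 | h1
    · exact h.ne (by omega) (by omega) (show i - 1 ≠ i + 1 by omega) (h1 (Or.inl rfl) (Or.inr rfl))
    · obtain ⟨w, hw, hwi⟩ : ∃ w < 2 * m, w ≠ i ∧ w ≠ i - 1 ∧ w ≠ i + 1 := by
        rcases Nat.lt_or_ge i 2 with h2 | h2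
        · exact ⟨3, by omega, by omega⟩
        · exact ⟨0, by omega, by omega⟩
      have : c w ∈ ({c (i - 1), c (i + 1)} : Set V) := by
        rw [h1]
        exact h.ne hw hi hwi.1
      rcases this with e | e
      · exact h.ne hw (by omega) hwi.2.1 e
      · exact h.ne hw (by omega) hwi.2.2 e
  · refine corner i (i - 1) 0 1 hi (by omega) (by omega) (by omega) (by omega) (by omega)
      (by omega) (by omega) (by omega) (by omega) (Or.inr fun k hk h0 h1 => ?_) hp
    exact ⟨(h.pos_iff hk (by omega)).mpr (by omega), h.val _ _ (by omega) (by omega)⟩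

end ParallelAlternation

/-- A nonempty critical structure has at least three elements. -/
theorem IsCritical.exists_ne_ne {V C : Type*} {r : V → V → C} (h : IsCritical r) (u v : V) :
    ∃ w, w ≠ u ∧ w ≠ v := by
  by_contra! hcon
  refine h.2 u fun M hM => Or.inl fun a ha b hb => ?_
  rw [hcon a (hM.1 ha), hcon b (hM.1 hb)]

end SimplePerm

theorem mainTheorem4 (n : ℕ) (hn : 1 ≤ n) (π : Equiv.Perm (Fin n)) :
    SimplePerm.IsExceptional π ↔
      ∃ (m : ℕ) (_ : 2 ≤ m) (h : 2 * m = n),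
        SimplePerm.IsSymmetry
          ((finCongr h).permCongr (SimplePerm.parallelAlternation m)) π := by
  open SimplePerm in
  have hcongr : ∀ m, (finCongr (rfl : 2 * m = 2 * m)).permCongr (parallelAlternation m) =
      parallelAlternation m := fun m => by
    ext i
    simp
  constructor
  · intro hπ
    have hplot := isPlot_self π
    have hg : Set.range (id : Fin n → Fin n) = Set.univ := Set.range_id
    obtain ⟨hP, hQ⟩ := hplot.injective_coords hg
    have hcrit := (hplot.isExceptional_iff hg).mp hπ
    have : Nonempty (Fin n) := ⟨⟨0, hn⟩⟩
    obtain ⟨P', Q', m, c, hm, hf, hc, huniv⟩ := hcrit.exists_alternation hP hQ hcrit.exists_ne_ne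
    obtain rfl : 2 * m = n := by
      rw [← hc.ncard_altSet, huniv, Set.ncard_univ, Nat.card_fin]
    obtain ⟨τ, g, hs, hτ, hg'⟩ := hplot.exists_of_symmForm hg hf
    obtain ⟨c', hc', huniv'⟩ := exists_isAlternation_parallelAlternation (m := m) (by omega)
    refine ⟨m, hm, rfl, ?_⟩
    rw [hcongr, (isPlot_self (parallelAlternation m)).eq_of_isAlternation hτ hg hg' hc' hc huniv'
      huniv]
    exact hs.symm
  · rintro ⟨m, hm, rfl, hs⟩
    rw [hcongr] at hs
    obtain ⟨c, hc, huniv⟩ := exists_isAlternation_parallelAlternation (m := m) (by omega)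
    have hplot := isPlot_self (parallelAlternation m)
    have hg : Set.range (id : Fin (2 * m) → Fin (2 * m)) = Set.univ := Set.range_id
    obtain ⟨hP, hQ⟩ := hplot.injective_coords hg
    obtain ⟨P', Q', g, hf, hπ, hg'⟩ := hplot.exists_of_isSymmetry hg hs
    rw [hπ.isExceptional_iff hg', hf.isCritical_iff hP hQ]
    exact hc.isCritical hm hP hQ huniv
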